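/- For $q,z\in\mathbb{C}$, $0<|q|<1$, let $\theta(q,z):=\sum_{j=0}^{\infty}q^{j(j+1)/2}z^j$ be the partial theta function; for fixed $q$ it is an entire function of $z$. A number $q$ with $0<|q|<1$ is called a spectral value of $\theta$ if $\theta(q,\cdot)$ has a multiple zero. Below, decimals followed by dots are truncated decimal expansions. For $0<|q|\leq 1/2$ the function $\theta$ has at least three (distinct) spectral values, which equal $$\tilde q_1=0.3092493386\ldots\quad\text{and}\quad v_{\pm}=0.4353184958\ldots\pm i\,0.1230440085\ldots ,\qquad v_-=\overline{v_+}.$$ The function $\theta(\tilde q_1,\cdot)$ has a double real negative zero $-7.5032559642\ldots$, and all its other zeros are real, negative, simple and $<-8$. The function $\theta(v_{\pm},\cdot)$ has a simple zero $-3.277\ldots\mp i\,1.483\ldots$ and a double zero $-5.963\ldots\pm i\,6.104\ldots$ (the zeros for $v_-$ being the complex conjugates of those for $v_+$), and its other zeros are simple and of modulus larger than $|v_{\pm}|^{-7/2}=16.0605003907\ldots$. -/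

import Mathlib

open ComplexConjugate

namespace PartialTheta

/-- The partial theta function `θ(q, z) = ∑_{j ≥ 0} q^{j(j+1)/2} z^j`.
The division of the even number `j (j + 1)` by `2` is exact, and the series converges
absolutely for `‖q‖ < 1` and all `z`. -/
noncomputable def theta (q z : ℂ) : ℂ := ∑' j : ℕ, q ^ (j * (j + 1) / 2) * z ^ j

/-- `z₀` is a zero of `θ(q, ·)` of multiplicity exactly `m`
(a simple zero for `m = 1`, a double zero for `m = 2`). -/
def IsZeroOfOrder (q z₀ : ℂ) (m : ℕ) : Prop :=
  theta q z₀ = 0 ∧ analyticOrderAt (theta q) z₀ = (m : ℕ∞)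

/-- `q` is a spectral value of `θ`: `0 < |q| < 1` and the entire function `θ(q, ·)` has a
multiple zero. -/
def IsSpectralValue (q : ℂ) : Prop :=
  0 < ‖q‖ ∧ ‖q‖ < 1 ∧ ∃ z₀ : ℂ, theta q z₀ = 0 ∧ 2 ≤ analyticOrderAt (theta q) z₀

end PartialTheta

open Filter Topology

namespace PartialTheta


/-! ### Weighted partial theta series -/

/-! Three independent arguments are combined: one locates the double zeros, one controls a disc, and
one controls the outside of the disc.

Location. A double zero of `θ(q, ·)` at `z ≠ 0` is a common zero of `θ` and `z ∂_z θ`, that is, of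
two theta series with weights `1` and `j`, in the two unknowns `(q, z)`. The Euler operators `q ∂_q`
and `z ∂_z` multiply weights by `j (j + 1) / 2` and `j`, so the Jacobian consists of series of the
same kind. At a double zero it is triangular, because `∂_z θ` vanishes. Newton's method with a
frozen triangular Jacobian is a contraction near the approximate solutions
(`exists_unique_zero_of_approx`, `exists_unique_double_zero`); its numerical hypotheses are checked
exactly in Gaussian integers. For the real spectral value, uniqueness together with invariance under
conjugation forces `q` and `z` to be real. The simple zero `a` comes from the same method with `q`
fixed (`exists_zero_near`).

Disc. Divide `θ(q, ·)` by the factors belonging to the known zeros. On a circle, `θ` is close to an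
explicit polynomial whose remaining roots lie outside the disc. A Rouché argument by the maximum
principle (`ne_zero_of_close_on_circle`) shows that the cofactor has no zero inside. Hence the
listed multiplicities are exact and there is no other zero in the disc.

Outside. The bilateral theta function equals `θ(q, z) + z⁻¹ θ(q, z⁻¹)`, so it differs from `θ` by a
small term when `|z|` is large. By the Jacobi triple product and quasi-periodicity its zeros are `-q
^ m`, `m ∈ ℤ`, one in each annulus of the family bounded by the odd powers of `s = √|q|`, and it is
bounded below there (`norm_fullTheta_ge`). Comparing divided differences (`dslope_ne_zero_of_close`)
gives at most one zero of `θ`, counted with multiplicity, in each annulus (`zeros_outside`). So the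
large zeros are simple, and two zeros of equal modulus coincide. For real `q` this makes them real,
and positivity of the coefficients makes them negative. The radii of the discs reach beyond `s ^
(-5)` and `s ^ (-7) = |v| ^ (-7/2)` respectively, which are inner edges of such annuli, so the two
regions cover the plane. -/

/-- The triangular numbers. -/
def tri (j : ℕ) : ℕ := j * (j + 1) / 2

lemma tri_zero : tri 0 = 0 := rfl

lemma tri_succ (j : ℕ) : tri (j + 1) = tri j + (j + 1) := by
  unfold tri
  have h : (j + 1) * (j + 1 + 1) = j * (j + 1) + (j + 1) * 2 := by ring
  rw [h, Nat.add_mul_div_right _ _ (by norm_num)]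

/-- A deliberately crude bound: every weight in use becomes at most `2 ^ j` or `4 ^ j`, and so can
be absorbed by enlarging the argument of the majorant. -/
lemma tri_le_two_pow (j : ℕ) : tri j ≤ 2 ^ j := by
  have h : ∀ j, j + 2 ≤ 2 ^ (j + 1) := by
    intro j
    induction j with
    | zero => norm_num
    | succ j ih => rw [pow_succ]; omega
  match j with
  | 0 => decide
  | 1 => decide
  | j + 2 =>
    induction j with
    | zero => decide
    | succ j ih =>
      have := h (j + 1)
      rw [show j + 1 + 2 = (j + 2) + 1 by ring, tri_succ, pow_succ]
      have h2 : 2 ^ (j + 2) = 2 ^ (j + 1 + 1) := rfl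
      omega

/-- The real majorant `∑ ρ ^ (j (j + 1) / 2) Y ^ j`. -/
noncomputable def majorant (ρ Y : ℝ) : ℝ := ∑' j : ℕ, ρ ^ tri j * Y ^ j

lemma summable_majorant {ρ : ℝ} (h0 : 0 ≤ ρ) (h1 : ρ < 1) (Y : ℝ) :
    Summable fun j : ℕ => ρ ^ tri j * Y ^ j := by
  have h : Filter.Tendsto (fun n : ℕ => ρ * ρ ^ n * |Y|) Filter.atTop (nhds (ρ * 0 * |Y|)) :=
    ((tendsto_pow_atTop_nhds_zero_of_lt_one h0 h1).const_mul ρ).mul_const |Y|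
  rw [mul_zero, zero_mul] at h
  refine summable_of_ratio_norm_eventually_le (r := 1 / 2) (by norm_num) ?_
  filter_upwards [h.eventually (ge_mem_nhds (show (0 : ℝ) < 1 / 2 by norm_num))] with n hn
  have e : ρ ^ tri (n + 1) * Y ^ (n + 1) = (ρ * ρ ^ n * Y) * (ρ ^ tri n * Y ^ n) := by
    rw [tri_succ]; ring
  rw [e, norm_mul]
  refine mul_le_mul_of_nonneg_right ?_ (norm_nonneg _)
  rwa [norm_mul, Real.norm_eq_abs, Real.norm_eq_abs, abs_of_nonneg (by positivity : 0 ≤ ρ * ρ ^ n)]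

/-- A geometric bound for the tail of the majorant. -/
lemma majorant_shift_le {ρ Y : ℝ} (h0 : 0 ≤ ρ) (h1 : ρ < 1) (hY : 0 ≤ Y) (N : ℕ)
    (hN : ρ ^ (N + 1) * Y ≤ 1 / 2) :
    ∑' j : ℕ, ρ ^ tri (j + N) * Y ^ (j + N) ≤ 2 * (ρ ^ tri N * Y ^ N) := by
  have hs := (summable_nat_add_iff N).mpr (summable_majorant h0 h1 Y)
  have hb : ∀ j : ℕ, ρ ^ tri (j + N) * Y ^ (j + N) ≤ (ρ ^ tri N * Y ^ N) * (1 / 2) ^ j := by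
    intro j
    induction j with
    | zero => simp
    | succ j ih =>
      have e : ρ ^ tri (j + 1 + N) * Y ^ (j + 1 + N)
          = (ρ ^ tri (j + N) * Y ^ (j + N)) * (ρ ^ j * (ρ ^ (N + 1) * Y)) := by
        rw [show j + 1 + N = (j + N) + 1 by ring, tri_succ]; ring
      rw [e, pow_succ (1 / 2 : ℝ) j, ← mul_assoc (ρ ^ tri N * Y ^ N)]
      refine mul_le_mul ih ?_ (by positivity) (by positivity)
      calc ρ ^ j * (ρ ^ (N + 1) * Y) ≤ 1 * (ρ ^ (N + 1) * Y) := by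
            gcongr; exact pow_le_one₀ h0 h1.le
        _ ≤ 1 / 2 := by rw [one_mul]; exact hN
  calc _ ≤ ∑' j : ℕ, (ρ ^ tri N * Y ^ N) * (1 / 2 : ℝ) ^ j :=
        Summable.tsum_le_tsum hb hs (summable_geometric_two.mul_left _)
    _ = _ := by rw [tsum_mul_left, tsum_geometric_two]; ring

lemma majorant_le {ρ Y : ℝ} (h0 : 0 ≤ ρ) (h1 : ρ < 1) (hY : 0 ≤ Y) (N : ℕ)
    (hN : ρ ^ (N + 1) * Y ≤ 1 / 2) :
    majorant ρ Y ≤ ∑ j ∈ Finset.range N, ρ ^ tri j * Y ^ j + 2 * (ρ ^ tri N * Y ^ N) := by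
  rw [majorant, ← (summable_majorant h0 h1 Y).sum_add_tsum_nat_add N]
  gcongr
  exact majorant_shift_le h0 h1 hY N hN

/-- The partial theta series with weights `p j`. -/
noncomputable def wtheta (p : ℕ → ℕ) (q z : ℂ) : ℂ := ∑' j : ℕ, (p j : ℂ) * (q ^ tri j * z ^ j)

lemma norm_wtheta_term_le {p : ℕ → ℕ} (hp : ∀ j, p j ≤ 4 ^ j) {q z : ℂ} {ρ Z : ℝ} (hq : ‖q‖ ≤ ρ)
    (hz : ‖z‖ ≤ Z) (j : ℕ) : ‖(p j : ℂ) * (q ^ tri j * z ^ j)‖ ≤ ρ ^ tri j * (4 * Z) ^ j := by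
  rw [norm_mul, norm_mul, norm_pow, norm_pow, Complex.norm_natCast, mul_pow]
  have h : (p j : ℝ) ≤ 4 ^ j := by exact_mod_cast hp j
  have h0 := (norm_nonneg q).trans hq
  calc (p j : ℝ) * (‖q‖ ^ tri j * ‖z‖ ^ j) ≤ 4 ^ j * (ρ ^ tri j * Z ^ j) := by gcongr
    _ = _ := by ring

lemma summable_wtheta {p : ℕ → ℕ} (hp : ∀ j, p j ≤ 4 ^ j) {q : ℂ} (hq : ‖q‖ < 1) (z : ℂ) :
    Summable fun j : ℕ => (p j : ℂ) * (q ^ tri j * z ^ j) :=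
  Summable.of_norm_bounded (summable_majorant (norm_nonneg q) hq (4 * ‖z‖))
    (norm_wtheta_term_le hp le_rfl le_rfl)

lemma norm_wtheta_sub_sum_le {p : ℕ → ℕ} (hp : ∀ j, p j ≤ 4 ^ j) {q z : ℂ} {ρ Z : ℝ}
    (hq : ‖q‖ ≤ ρ) (h1 : ρ < 1) (hz : ‖z‖ ≤ Z) (N : ℕ) (hN : ρ ^ (N + 1) * (4 * Z) ≤ 1 / 2) :
    ‖wtheta p q z - ∑ j ∈ Finset.range N, (p j : ℂ) * (q ^ tri j * z ^ j)‖
      ≤ 2 * (ρ ^ tri N * (4 * Z) ^ N) := by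
  have h0 := (norm_nonneg q).trans hq
  have hZ := (norm_nonneg z).trans hz
  rw [wtheta, ← (summable_wtheta hp (hq.trans_lt h1) z).sum_add_tsum_nat_add N,
    add_sub_cancel_left]
  refine le_trans (tsum_of_norm_bounded
    ((summable_nat_add_iff N).mpr (summable_majorant h0 h1 (4 * Z))).hasSum
    fun j => norm_wtheta_term_le hp hq hz (j + N)) ?_
  exact majorant_shift_le h0 h1 (by positivity) N hN

lemma theta_eq_wtheta (q z : ℂ) : theta q z = wtheta (fun _ => 1) q z := by
  simp [theta, wtheta, tri]

lemma theta_eq_tsum (q z : ℂ) : theta q z = ∑' j : ℕ, q ^ tri j * z ^ j := rfl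

lemma summable_theta {q : ℂ} (hq : ‖q‖ < 1) (z : ℂ) : Summable fun j : ℕ => q ^ tri j * z ^ j := by
  simpa using summable_wtheta (p := fun _ => 1) (fun j => Nat.one_le_pow _ _ (by norm_num)) hq z

lemma norm_theta_le {q z : ℂ} (hq : ‖q‖ < 1) {Z : ℝ} (hz : ‖z‖ ≤ Z) :
    ‖theta q z‖ ≤ majorant ‖q‖ Z := by
  refine tsum_of_norm_bounded (summable_majorant (norm_nonneg q) hq Z).hasSum fun j => ?_
  rw [norm_mul, norm_pow, norm_pow]
  exact mul_le_mul_of_nonneg_left (pow_le_pow_left₀ (norm_nonneg z) hz j) (by positivity)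

/-- The functional equation of the partial theta function. -/
lemma theta_functional {q : ℂ} (hq : ‖q‖ < 1) (z : ℂ) :
    theta q z = 1 + q * z * theta q (q * z) := by
  rw [theta_eq_tsum, theta_eq_tsum, (summable_theta hq z).tsum_eq_zero_add, ← tsum_mul_left]
  congr 1
  · simp [tri_zero]
  · refine tsum_congr fun j => ?_
    rw [tri_succ]; ring

lemma conj_theta (q z : ℂ) : theta (conj q) (conj z) = conj (theta q z) := by
  rw [theta_eq_tsum, theta_eq_tsum, Complex.conj_tsum]
  simp

lemma hasSum_deriv_theta {q : ℂ} (hq : ‖q‖ < 1) (z : ℂ) :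
    DifferentiableAt ℂ (theta q) z ∧
      HasSum (fun j : ℕ => deriv (fun w => q ^ tri j * w ^ j) z) (deriv (theta q) z) := by
  have hu := summable_majorant (norm_nonneg q) hq (‖z‖ + 1)
  have hd : ∀ j : ℕ, DifferentiableOn ℂ (fun w : ℂ => q ^ tri j * w ^ j)
      (Metric.ball 0 (‖z‖ + 1)) := fun j => by fun_prop
  have hb : ∀ (j : ℕ), ∀ w ∈ Metric.ball (0 : ℂ) (‖z‖ + 1),
      ‖q ^ tri j * w ^ j‖ ≤ ‖q‖ ^ tri j * (‖z‖ + 1) ^ j := by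
    intro j w hw
    rw [mem_ball_zero_iff] at hw
    rw [norm_mul, norm_pow, norm_pow]
    gcongr
  have hz : z ∈ Metric.ball (0 : ℂ) (‖z‖ + 1) := by simp
  exact ⟨(Complex.differentiableOn_tsum_of_summable_norm hu hd Metric.isOpen_ball hb).differentiableAt
      (Metric.isOpen_ball.mem_nhds hz),
    Complex.hasSum_deriv_of_summable_norm hu hd Metric.isOpen_ball hb hz⟩

lemma differentiable_theta {q : ℂ} (hq : ‖q‖ < 1) : Differentiable ℂ (theta q) :=
  fun z => (hasSum_deriv_theta hq z).1

/-- Using the Euler operator `z ∂_z` instead of `∂_z` keeps the exponents in place, so derivatives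
remain weighted theta series. -/
lemma mul_deriv_theta {q : ℂ} (hq : ‖q‖ < 1) (z : ℂ) :
    z * deriv (theta q) z = wtheta id q z := by
  rw [wtheta, ← ((hasSum_deriv_theta hq z).2.mul_left z).tsum_eq]
  refine tsum_congr fun j => ?_
  cases j with
  | zero => simp
  | succ j => simp; ring


/-! ### Linear approximation of weighted theta series and Newton's method -/

lemma norm_pow_sub_pow_le_of_norm_le {x y : ℂ} {M : ℝ} (hM : 0 < M) (hx : ‖x‖ ≤ M) (hy : ‖y‖ ≤ M)
    (n : ℕ) : ‖x ^ n - y ^ n‖ ≤ n * (M ^ n / M) * ‖x - y‖ := by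
  induction n with
  | zero => simp
  | succ n ih =>
    have e : x ^ (n + 1) - y ^ (n + 1) = x ^ n * (x - y) + (x ^ n - y ^ n) * y := by ring
    have h1 : ‖x ^ n * (x - y)‖ ≤ M ^ n * ‖x - y‖ := by
      rw [norm_mul, norm_pow]; gcongr
    have h2 : ‖(x ^ n - y ^ n) * y‖ ≤ (n * (M ^ n / M) * ‖x - y‖) * M := by
      rw [norm_mul]; gcongr
    rw [e]
    refine (norm_add_le_of_le h1 h2).trans (le_of_eq ?_)
    push_cast; field_simp; ring

/-- The derivative `n a ^ (n - 1)` is written `n a ^ n / a` throughout, which avoids truncated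
subtraction in the exponent and matches the Euler operators. -/
lemma norm_natCast_mul_pow_div_le {a : ℂ} {M : ℝ} (ha0 : a ≠ 0) (hM : 0 < M) (ha : ‖a‖ ≤ M)
    (n : ℕ) : ‖(n : ℂ) * a ^ n / a‖ ≤ n * (M ^ n / M) := by
  cases n with
  | zero => simp
  | succ n =>
    rw [mul_div_assoc, pow_succ, mul_div_cancel_right₀ _ ha0, pow_succ,
      mul_div_cancel_right₀ _ hM.ne', norm_mul, Complex.norm_natCast, norm_pow]
    gcongr

/-- A second-order estimate in which the derivative is frozen at the centre `a` rather than taken at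
`x` or `y`. This is what a Newton iteration with constant Jacobian requires. -/
lemma norm_pow_sub_pow_sub_le {x y a : ℂ} {M ε : ℝ} (ha0 : a ≠ 0) (hM : 0 < M) (hx : ‖x‖ ≤ M)
    (hy : ‖y‖ ≤ M) (ha : ‖a‖ ≤ M) (hxa : ‖x - a‖ ≤ ε) (hya : ‖y - a‖ ≤ ε) (n : ℕ) :
    ‖x ^ n - y ^ n - n * a ^ n / a * (x - y)‖ ≤ n ^ 2 * (M ^ n / M ^ 2) * ε * ‖x - y‖ := by
  have hε := (norm_nonneg _).trans hxa
  induction n with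
  | zero => simp
  | succ n ih =>
    have e : x ^ (n + 1) - y ^ (n + 1) - ((n + 1 : ℕ) : ℂ) * a ^ (n + 1) / a * (x - y)
        = (x ^ n - y ^ n - n * a ^ n / a * (x - y)) * y + (x ^ n - a ^ n) * (x - y)
          + (n * a ^ n / a) * (y - a) * (x - y) := by
      push_cast; field_simp; ring
    have h1 : ‖(x ^ n - y ^ n - n * a ^ n / a * (x - y)) * y‖
        ≤ (n ^ 2 * (M ^ n / M ^ 2) * ε * ‖x - y‖) * M := by
      rw [norm_mul]; gcongr
    have h2 : ‖(x ^ n - a ^ n) * (x - y)‖ ≤ (n * (M ^ n / M) * ε) * ‖x - y‖ := by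
      rw [norm_mul]
      gcongr
      refine (norm_pow_sub_pow_le_of_norm_le hM hx ha n).trans ?_
      gcongr
    have h3 : ‖(n * a ^ n / a) * (y - a) * (x - y)‖ ≤ (n * (M ^ n / M)) * ε * ‖x - y‖ := by
      rw [norm_mul, norm_mul]
      gcongr
      exact norm_natCast_mul_pow_div_le ha0 hM ha n
    rw [e]
    refine (norm_add_le_of_le (norm_add_le_of_le h1 h2) h3).trans ?_
    have h4 : 0 ≤ M ^ n / M * ε * ‖x - y‖ := by positivity
    have e2 : ((n + 1 : ℕ) : ℝ) ^ 2 * (M ^ (n + 1) / M ^ 2) * ε * ‖x - y‖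
        = ((n : ℝ) + 1) ^ 2 * (M ^ n / M * ε * ‖x - y‖) := by
      push_cast; field_simp; ring
    have e3 : (n ^ 2 * (M ^ n / M ^ 2) * ε * ‖x - y‖) * M + (n * (M ^ n / M) * ε) * ‖x - y‖
        + (n * (M ^ n / M)) * ε * ‖x - y‖ = ((n : ℝ) ^ 2 + 2 * n) * (M ^ n / M * ε * ‖x - y‖) := by
      field_simp; ring
    rw [e2, e3]
    gcongr
    nlinarith

/-- The monomials of the theta series are approximately linear near a point `(q₀, z₀)`. -/
lemma norm_monomial_sub_le {q q' q₀ z z' z₀ : ℂ} {ρ Z ε d : ℝ} (hq₀ : q₀ ≠ 0) (hz₀ : z₀ ≠ 0)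
    (hρ : 0 < ρ) (hZ : 0 < Z) (h1 : ‖q‖ ≤ ρ) (h2 : ‖q'‖ ≤ ρ) (h3 : ‖q₀‖ ≤ ρ) (h4 : ‖z‖ ≤ Z)
    (h5 : ‖z'‖ ≤ Z) (h6 : ‖z₀‖ ≤ Z) (e1 : ‖q - q₀‖ ≤ ε) (e2 : ‖q' - q₀‖ ≤ ε) (e3 : ‖z - z₀‖ ≤ ε)
    (e4 : ‖z' - z₀‖ ≤ ε) (d1 : ‖q - q'‖ ≤ d) (d2 : ‖z - z'‖ ≤ d) (m j : ℕ) :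
    ‖q ^ m * z ^ j - q' ^ m * z' ^ j - (m * (q₀ ^ m * z₀ ^ j) / q₀ * (q - q')
      + j * (q₀ ^ m * z₀ ^ j) / z₀ * (z - z'))‖
      ≤ ρ ^ m * Z ^ j * (m / ρ + j / Z) ^ 2 * ε * d := by
  have hε := (norm_nonneg _).trans e1
  have hd := (norm_nonneg _).trans d1
  have e : q ^ m * z ^ j - q' ^ m * z' ^ j - (m * (q₀ ^ m * z₀ ^ j) / q₀ * (q - q')
      + j * (q₀ ^ m * z₀ ^ j) / z₀ * (z - z'))
      = (q ^ m - q' ^ m - m * q₀ ^ m / q₀ * (q - q')) * z ^ j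
        + (m * q₀ ^ m / q₀) * (q - q') * (z ^ j - z₀ ^ j)
        + (q' ^ m - q₀ ^ m) * (z ^ j - z' ^ j)
        + q₀ ^ m * (z ^ j - z' ^ j - j * z₀ ^ j / z₀ * (z - z')) := by
    field_simp; ring
  have b1 : ‖(q ^ m - q' ^ m - m * q₀ ^ m / q₀ * (q - q')) * z ^ j‖
      ≤ (m ^ 2 * (ρ ^ m / ρ ^ 2) * ε * d) * Z ^ j := by
    rw [norm_mul, norm_pow]
    gcongr
    refine (norm_pow_sub_pow_sub_le hq₀ hρ h1 h2 h3 e1 e2 m).trans ?_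
    gcongr
  have b2 : ‖(m * q₀ ^ m / q₀) * (q - q') * (z ^ j - z₀ ^ j)‖
      ≤ (m * (ρ ^ m / ρ)) * d * (j * (Z ^ j / Z) * ε) := by
    rw [norm_mul, norm_mul]
    gcongr
    · exact norm_natCast_mul_pow_div_le hq₀ hρ h3 m
    · refine (norm_pow_sub_pow_le_of_norm_le hZ h4 h6 j).trans ?_
      gcongr
  have b3 : ‖(q' ^ m - q₀ ^ m) * (z ^ j - z' ^ j)‖
      ≤ (m * (ρ ^ m / ρ) * ε) * (j * (Z ^ j / Z) * d) := by
    rw [norm_mul]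
    gcongr
    · refine (norm_pow_sub_pow_le_of_norm_le hρ h2 h3 m).trans ?_
      gcongr
    · refine (norm_pow_sub_pow_le_of_norm_le hZ h4 h5 j).trans ?_
      gcongr
  have b4 : ‖q₀ ^ m * (z ^ j - z' ^ j - j * z₀ ^ j / z₀ * (z - z'))‖
      ≤ ρ ^ m * (j ^ 2 * (Z ^ j / Z ^ 2) * ε * d) := by
    rw [norm_mul, norm_pow]
    gcongr
    refine (norm_pow_sub_pow_sub_le hz₀ hZ h4 h5 h6 e3 e4 j).trans ?_
    gcongr
  rw [e]
  refine (norm_add_le_of_le (norm_add_le_of_le (norm_add_le_of_le b1 b2) b3) b4).trans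
    (le_of_eq ?_)
  field_simp
  ring

lemma nat_le_two_pow (j : ℕ) : j ≤ 2 ^ j := Nat.lt_two_pow_self.le

/-- Termwise summation of the monomial estimate. Since `ρ ≥ 1/4` and `Z ≥ 1`, the factor `tri j / ρ
+ j / Z` is at most `5 * 2 ^ j`; its square times `p j ≤ 2 ^ j` is at most `25 * 8 ^ j`, whence the
constant `25` and the argument `8 * Z`. -/
lemma norm_wtheta_sub_le {p : ℕ → ℕ} (hp : ∀ j, p j ≤ 2 ^ j) {q q' q₀ z z' z₀ : ℂ}
    {ρ Z ε d : ℝ} (hq₀ : q₀ ≠ 0) (hz₀ : z₀ ≠ 0)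
    (hρ : 1 / 4 ≤ ρ) (hρ1 : ρ < 1) (hZ : 1 ≤ Z) (h1 : ‖q‖ ≤ ρ) (h2 : ‖q'‖ ≤ ρ) (h3 : ‖q₀‖ ≤ ρ)
    (h4 : ‖z‖ ≤ Z) (h5 : ‖z'‖ ≤ Z) (h6 : ‖z₀‖ ≤ Z) (e1 : ‖q - q₀‖ ≤ ε) (e2 : ‖q' - q₀‖ ≤ ε)
    (e3 : ‖z - z₀‖ ≤ ε) (e4 : ‖z' - z₀‖ ≤ ε) (d1 : ‖q - q'‖ ≤ d) (d2 : ‖z - z'‖ ≤ d) :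
    ‖wtheta p q z - wtheta p q' z' - (wtheta (fun j => p j * tri j) q₀ z₀ / q₀ * (q - q')
      + wtheta (fun j => p j * j) q₀ z₀ / z₀ * (z - z'))‖ ≤ 25 * majorant ρ (8 * Z) * ε * d := by
  have hε := (norm_nonneg _).trans e1
  have hd := (norm_nonneg _).trans d1
  have hρ0 : 0 < ρ := by linarith
  have hZ0 : 0 < Z := by linarith
  have p24 : ∀ j : ℕ, 2 ^ j * 2 ^ j = 4 ^ j := fun j => by rw [← mul_pow]; norm_num
  have hp0 : ∀ j, p j ≤ 4 ^ j := fun j =>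
    (hp j).trans (Nat.pow_le_pow_left (by norm_num) j)
  have hp1 : ∀ j, p j * tri j ≤ 4 ^ j := fun j =>
    (Nat.mul_le_mul (hp j) (tri_le_two_pow j)).trans_eq (p24 j)
  have hp2 : ∀ j, p j * j ≤ 4 ^ j := fun j =>
    (Nat.mul_le_mul (hp j) (nat_le_two_pow j)).trans_eq (p24 j)
  have s := ((summable_wtheta hp0 (h1.trans_lt hρ1) z).hasSum.sub
    (summable_wtheta hp0 (h2.trans_lt hρ1) z').hasSum).sub
    ((((summable_wtheta hp1 (h3.trans_lt hρ1) z₀).hasSum.div_const q₀).mul_right (q - q')).add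
    (((summable_wtheta hp2 (h3.trans_lt hρ1) z₀).hasSum.div_const z₀).mul_right (z - z')))
  have hm := ((summable_majorant hρ0.le hρ1 (8 * Z)).hasSum.mul_left 25).mul_right (ε * d)
  have hm' : 25 * majorant ρ (8 * Z) * ε * d = 25 * majorant ρ (8 * Z) * (ε * d) := by ring
  rw [hm']
  unfold wtheta
  rw [← s.tsum_eq]
  refine tsum_of_norm_bounded hm fun j => ?_
  have e : (p j : ℂ) * (q ^ tri j * z ^ j) - p j * (q' ^ tri j * z' ^ j)
      - (((p j * tri j : ℕ) : ℂ) * (q₀ ^ tri j * z₀ ^ j) / q₀ * (q - q')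
        + ((p j * j : ℕ) : ℂ) * (q₀ ^ tri j * z₀ ^ j) / z₀ * (z - z'))
      = p j * (q ^ tri j * z ^ j - q' ^ tri j * z' ^ j
        - ((tri j : ℕ) * (q₀ ^ tri j * z₀ ^ j) / q₀ * (q - q')
        + j * (q₀ ^ tri j * z₀ ^ j) / z₀ * (z - z'))) := by
    push_cast; ring
  rw [e, norm_mul, Complex.norm_natCast]
  have b := norm_monomial_sub_le hq₀ hz₀ hρ0 hZ0 h1 h2 h3 h4 h5 h6 e1 e2 e3 e4 d1 d2 (tri j) j
  have c1 : (p j : ℝ) ≤ 2 ^ j := by exact_mod_cast hp j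
  have c2 : (tri j : ℝ) ≤ 2 ^ j := by exact_mod_cast tri_le_two_pow j
  have c3 : (j : ℝ) ≤ 2 ^ j := by exact_mod_cast nat_le_two_pow j
  have c4 : (tri j : ℝ) / ρ + j / Z ≤ 5 * 2 ^ j := by
    have : (tri j : ℝ) / ρ ≤ 2 ^ j * 4 := by
      rw [div_le_iff₀ hρ0]; nlinarith [pow_pos (show (0 : ℝ) < 2 by norm_num) j]
    have : (j : ℝ) / Z ≤ 2 ^ j := (div_le_self (by positivity) hZ).trans c3
    linarith
  calc _ ≤ 2 ^ j * (ρ ^ tri j * Z ^ j * (5 * 2 ^ j) ^ 2 * ε * d) := by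
        gcongr
        exact b.trans (by gcongr)
    _ = 25 * (ρ ^ tri j * (8 * Z) ^ j) * (ε * d) := by
        rw [mul_pow 8 Z, show (8 : ℝ) = 2 ^ 3 by norm_num, ← pow_mul, mul_comm 3 j, pow_mul]; ring

/-- Newton's method for a triangular system of two equations, in the form of an existence and
uniqueness statement. -/
lemma exists_unique_zero_of_approx {f g : ℂ → ℂ → ℂ} {x₀ y₀ A C E : ℂ} {ε c c' : ℝ} (hε : 0 < ε)
    (hA : A ≠ 0) (hE : E ≠ 0)
    (hf : ∀ x x' y y', ‖x - x₀‖ ≤ ε → ‖x' - x₀‖ ≤ ε → ‖y - y₀‖ ≤ ε → ‖y' - y₀‖ ≤ ε →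
      ‖f x y - f x' y' - A * (x - x')‖ ≤ c * max ‖x - x'‖ ‖y - y'‖)
    (hg : ∀ x x' y y', ‖x - x₀‖ ≤ ε → ‖x' - x₀‖ ≤ ε → ‖y - y₀‖ ≤ ε → ‖y' - y₀‖ ≤ ε →
      ‖g x y - g x' y' - (C * (x - x') + E * (y - y'))‖ ≤ c' * max ‖x - x'‖ ‖y - y'‖)
    (hc : c ≤ ‖A‖ / 2) (hc' : c' + ‖C‖ * c / ‖A‖ ≤ ‖E‖ / 2)
    (h0 : ‖f x₀ y₀‖ ≤ ‖A‖ * ε / 2) (h0' : ‖g x₀ y₀‖ + ‖C‖ * ‖f x₀ y₀‖ / ‖A‖ ≤ ‖E‖ * ε / 2) :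
    (∃ x y, ‖x - x₀‖ ≤ ε ∧ ‖y - y₀‖ ≤ ε ∧ f x y = 0 ∧ g x y = 0) ∧
    ∀ x x' y y', ‖x - x₀‖ ≤ ε → ‖x' - x₀‖ ≤ ε → ‖y - y₀‖ ≤ ε → ‖y' - y₀‖ ≤ ε →
      f x y = 0 → g x y = 0 → f x' y' = 0 → g x' y' = 0 → x = x' ∧ y = y' := by
  have hA' : 0 < ‖A‖ := norm_pos_iff.mpr hA
  have hE' : 0 < ‖E‖ := norm_pos_iff.mpr hE
  -- The Newton step for the frozen lower triangular Jacobian with rows `(A, 0)` and `(C, E)`: the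
  -- first row is solved and substituted into the second.
  set T : ℂ × ℂ → ℂ × ℂ := fun u =>
    (u.1 - f u.1 u.2 / A, u.2 - (g u.1 u.2 - C * f u.1 u.2 / A) / E) with hT
  set s : Set (ℂ × ℂ) := Metric.closedBall (x₀, y₀) ε with hs
  have mem : ∀ u : ℂ × ℂ, u ∈ s ↔ ‖u.1 - x₀‖ ≤ ε ∧ ‖u.2 - y₀‖ ≤ ε := by
    intro u
    rw [hs, Metric.mem_closedBall, Prod.dist_eq, max_le_iff, dist_eq_norm, dist_eq_norm]
  have lip : ∀ u ∈ s, ∀ u' ∈ s, dist (T u) (T u') ≤ 1 / 2 * dist u u' := by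
    intro u hu u' hu'
    obtain ⟨a1, a2⟩ := (mem u).mp hu
    obtain ⟨b1, b2⟩ := (mem u').mp hu'
    have F := hf _ _ _ _ a1 b1 a2 b2
    have G := hg _ _ _ _ a1 b1 a2 b2
    rw [Prod.dist_eq, Prod.dist_eq, dist_eq_norm, dist_eq_norm, dist_eq_norm, dist_eq_norm]
    set d := max ‖u.1 - u'.1‖ ‖u.2 - u'.2‖ with hd
    have hd0 : 0 ≤ d := le_max_of_le_left (norm_nonneg _)
    set φ := f u.1 u.2 - f u'.1 u'.2 - A * (u.1 - u'.1) with hφ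
    set ψ := g u.1 u.2 - g u'.1 u'.2 - (C * (u.1 - u'.1) + E * (u.2 - u'.2)) with hψ
    have E1 : (T u).1 - (T u').1 = -(φ / A) := by
      simp only [hT, hφ]; field_simp; ring
    have E2 : (T u).2 - (T u').2 = -((ψ - C * φ / A) / E) := by
      simp only [hT, hφ, hψ]; field_simp; ring
    refine max_le ?_ ?_
    · rw [E1, norm_neg, norm_div, div_le_iff₀ hA']
      calc ‖φ‖ ≤ c * d := F
        _ ≤ ‖A‖ / 2 * d := by gcongr
        _ = _ := by ring
    · rw [E2, norm_neg, norm_div, div_le_iff₀ hE']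
      calc ‖ψ - C * φ / A‖ ≤ ‖ψ‖ + ‖C‖ * ‖φ‖ / ‖A‖ := by
            rw [← norm_mul, ← norm_div]; exact norm_sub_le _ _
        _ ≤ c' * d + ‖C‖ * (c * d) / ‖A‖ := by gcongr
        _ = (c' + ‖C‖ * c / ‖A‖) * d := by ring
        _ ≤ ‖E‖ / 2 * d := by gcongr
        _ = _ := by ring
  have hc0 : (x₀, y₀) ∈ s := Metric.mem_closedBall_self hε.le
  have hT0 : dist (T (x₀, y₀)) (x₀, y₀) ≤ ε / 2 := by
    rw [Prod.dist_eq, dist_eq_norm, dist_eq_norm]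
    refine max_le ?_ ?_
    · have : (T (x₀, y₀)).1 - (x₀, y₀).1 = -(f x₀ y₀ / A) := by simp only [hT]; ring
      rw [this, norm_neg, norm_div, div_le_iff₀ hA']; linarith
    · have : (T (x₀, y₀)).2 - (x₀, y₀).2 = -((g x₀ y₀ - C * f x₀ y₀ / A) / E) := by
        simp only [hT]; ring
      rw [this, norm_neg, norm_div, div_le_iff₀ hE']
      calc _ ≤ ‖g x₀ y₀‖ + ‖C‖ * ‖f x₀ y₀‖ / ‖A‖ := by
            rw [← norm_mul, ← norm_div]; exact norm_sub_le _ _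
        _ ≤ _ := by linarith
  have maps : Set.MapsTo T s s := by
    intro u hu
    rw [hs, Metric.mem_closedBall] at hu ⊢
    have := lip u hu _ hc0
    have := dist_triangle (T u) (T (x₀, y₀)) (x₀, y₀)
    linarith
  -- As `A` and `E` are nonzero, fixed points are exactly common zeros. The factor `1 / 2` in `lip`
  -- then yields uniqueness, and the Banach fixed point theorem yields existence.
  have fix : ∀ u : ℂ × ℂ, T u = u ↔ f u.1 u.2 = 0 ∧ g u.1 u.2 = 0 := by
    intro u
    simp only [hT, Prod.ext_iff, sub_eq_self]
    constructor
    · rintro ⟨h, h'⟩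
      have h1 : f u.1 u.2 = 0 := by simpa [hA] using h
      refine ⟨h1, ?_⟩
      rw [h1] at h'
      simpa [hE] using h'
    · rintro ⟨h, h'⟩; simp [h, h']
  refine ⟨?_, ?_⟩
  · have hcon : ContractingWith (1 / 2) (Set.MapsTo.restrict T s s maps) := by
      refine ⟨by norm_num, LipschitzWith.of_dist_le_mul fun u u' => ?_⟩
      exact_mod_cast lip u u.2 u' u'.2
    obtain ⟨u, hu, hfix, -⟩ := ContractingWith.exists_fixedPoint'
      Metric.isClosed_closedBall.isComplete maps hcon hc0 (edist_ne_top _ _)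
    obtain ⟨a1, a2⟩ := (mem u).mp hu
    obtain ⟨b1, b2⟩ := (fix u).mp hfix
    exact ⟨u.1, u.2, a1, a2, b1, b2⟩
  · intro x x' y y' a1 b1 a2 b2 f1 g1 f2 g2
    have h := lip (x, y) ((mem _).mpr ⟨a1, a2⟩) (x', y') ((mem _).mpr ⟨b1, b2⟩)
    rw [(fix (x, y)).mpr ⟨f1, g1⟩, (fix (x', y')).mpr ⟨f2, g2⟩] at h
    have h2 : dist (x, y) (x', y') ≤ 0 := by linarith [dist_nonneg (x := (x, y)) (y := (x', y'))]
    exact Prod.ext_iff.mp (dist_le_zero.mp h2)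


/-! ### Exact evaluation of truncated theta series at Gaussian rationals -/

lemma sq_norm_toComplex (g : GaussianInt) : ‖GaussianInt.toComplex g‖ ^ 2 = (g.norm : ℝ) := by
  rw [Complex.sq_norm]
  exact_mod_cast (GaussianInt.intCast_complex_norm g).symm

lemma norm_toComplex_le {g : GaussianInt} {t : ℕ} (h : g.norm ≤ t ^ 2) :
    ‖GaussianInt.toComplex g‖ ≤ t := by
  refine le_of_sq_le_sq ?_ (Nat.cast_nonneg t)
  rw [sq_norm_toComplex]
  exact_mod_cast h

lemma le_norm_toComplex {g : GaussianInt} {t : ℕ} (h : (t : ℤ) ^ 2 ≤ g.norm) :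
    t ≤ ‖GaussianInt.toComplex g‖ := by
  refine le_of_sq_le_sq ?_ (norm_nonneg _)
  rw [sq_norm_toComplex]
  exact_mod_cast h

/-- Horner evaluation of `∑_{i ≤ n} p (j + i) q ^ (tri (j + i) - tri j) z ^ i`. -/
noncomputable def hornerEval (p : ℕ → ℕ) (q z : ℂ) : ℕ → ℕ → ℂ
  | 0, j => p j
  | n + 1, j => p j + q ^ (j + 1) * z * hornerEval p q z n (j + 1)

/-- Consecutive monomials have ratio `q ^ (j + 1) * z`, so a Horner scheme evaluates the partial sum
without forming the large powers `q ^ tri j` separately. -/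
lemma sum_eq_hornerEval (p : ℕ → ℕ) (q z : ℂ) (n j : ℕ) :
    ∑ i ∈ Finset.range (n + 1), (p (j + i) : ℂ) * (q ^ tri (j + i) * z ^ (j + i))
      = q ^ tri j * z ^ j * hornerEval p q z n j := by
  induction n generalizing j with
  | zero => simp [hornerEval]; ring
  | succ n ih =>
    rw [Finset.sum_range_succ', hornerEval, mul_add]
    have h : ∑ i ∈ Finset.range (n + 1),
        (p (j + (i + 1)) : ℂ) * (q ^ tri (j + (i + 1)) * z ^ (j + (i + 1)))
        = ∑ i ∈ Finset.range (n + 1), (p (j + 1 + i) : ℂ) * (q ^ tri (j + 1 + i) * z ^ (j + 1 + i)) :=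
      Finset.sum_congr rfl fun i _ => by rw [show j + (i + 1) = j + 1 + i by ring]
    rw [h, ih (j + 1), tri_succ, add_zero]
    ring

/-- The exponent of the common denominator in `hornerNum`. -/
def hornerExp : ℕ → ℕ → ℕ
  | 0, _ => 0
  | n + 1, j => j + 2 + hornerExp n (j + 1)

/-- The numerator of `hornerEval` at a Gaussian rational point `(A / D, B / D)`. -/
def hornerNum (p : ℕ → ℕ) (A B : GaussianInt) (D : ℕ) : ℕ → ℕ → GaussianInt
  | 0, j => p j
  | n + 1, j => p j * (D : GaussianInt) ^ hornerExp (n + 1) j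
      + A ^ (j + 1) * B * hornerNum p A B D n (j + 1)

lemma hornerEval_eq (p : ℕ → ℕ) (A B : GaussianInt) {D : ℕ} (hD : D ≠ 0) (n j : ℕ) :
    hornerEval p (GaussianInt.toComplex A / D) (GaussianInt.toComplex B / D) n j
      = GaussianInt.toComplex (hornerNum p A B D n j) / (D : ℂ) ^ hornerExp n j := by
  have hD' : (D : ℂ) ≠ 0 := Nat.cast_ne_zero.mpr hD
  induction n generalizing j with
  | zero => simp [hornerEval, hornerNum, hornerExp]
  | succ n ih =>
    rw [hornerEval, hornerNum, ih, hornerExp]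
    simp only [map_add, map_mul, map_pow, map_natCast]
    have e : (D : ℂ) ^ (j + 2 + hornerExp n (j + 1))
        = (D : ℂ) ^ (j + 1) * D * (D : ℂ) ^ hornerExp n (j + 1) := by ring
    rw [e, div_pow, eq_div_iff (by positivity)]
    field_simp

/-- An exact computation over the Gaussian integers certifying the value of a weighted theta
series. -/
lemma norm_wtheta_sub_le_of_hornerNum {p : ℕ → ℕ} (hp : ∀ j, p j ≤ 4 ^ j) {A B c : GaussianInt}
    {D K L n : ℕ} (hD : D ≠ 0) (hK : K ≠ 0) (hL : L ≠ 0) {ρ Z δ : ℝ}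
    (hA : ‖GaussianInt.toComplex A / D‖ ≤ ρ)
    (h1 : ρ < 1) (hB : ‖GaussianInt.toComplex B / D‖ ≤ Z)
    (hn : ρ ^ (n + 1 + 1) * (4 * Z) ≤ 1 / 2)
    (hδ : 1 / L + 2 * (ρ ^ tri (n + 1) * (4 * Z) ^ (n + 1)) ≤ δ)
    (h : (hornerNum p A B D n 0 * K - c * (D : GaussianInt) ^ hornerExp n 0).norm * L ^ 2
      ≤ (K * D ^ hornerExp n 0) ^ 2) :
    ‖wtheta p (GaussianInt.toComplex A / D) (GaussianInt.toComplex B / D)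
      - GaussianInt.toComplex c / K‖ ≤ δ := by
  have hD' : (D : ℂ) ≠ 0 := Nat.cast_ne_zero.mpr hD
  have hK' : (K : ℂ) ≠ 0 := Nat.cast_ne_zero.mpr hK
  have s := sum_eq_hornerEval p (GaussianInt.toComplex A / D) (GaussianInt.toComplex B / D) n 0
  simp only [zero_add, tri_zero, pow_zero, one_mul] at s
  have t := norm_wtheta_sub_sum_le hp hA h1 hB (n + 1) hn
  rw [s, hornerEval_eq p A B hD] at t
  refine le_trans ?_ hδ
  rw [add_comm]
  refine (norm_sub_le_norm_sub_add_norm_sub _ _ _).trans (add_le_add t ?_)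
  have e : GaussianInt.toComplex (hornerNum p A B D n 0) / (D : ℂ) ^ hornerExp n 0
      - GaussianInt.toComplex c / K
      = GaussianInt.toComplex (hornerNum p A B D n 0 * K - c * (D : GaussianInt) ^ hornerExp n 0)
        / ((K * D ^ hornerExp n 0 : ℕ) : ℂ) := by
    push_cast
    simp only [map_sub, map_mul, map_pow, map_natCast]
    field_simp
  have hpos : (0 : ℝ) < ((K * D ^ hornerExp n 0 : ℕ) : ℝ) := by positivity
  have hL' : (0 : ℝ) < L := by positivity
  rw [e, norm_div, Complex.norm_natCast, div_le_div_iff₀ hpos hL', one_mul]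
  -- Squaring turns the comparison of complex norms into an inequality between integers, which the
  -- kernel can decide.
  refine le_of_sq_le_sq ?_ hpos.le
  rw [mul_pow, sq_norm_toComplex]
  exact_mod_cast h

/-- A quantitative criterion for the existence of a unique double zero near `(q₀, z₀)`. -/
lemma exists_unique_double_zero {q₀ z₀ c₁ c₂ c₃ : ℂ} {ρ Z Mb ε τ σ : ℝ}
    (hε : 0 < ε) (hq₀ : 1 / 4 ≤ ‖q₀‖) (hz₀ : 1 ≤ ‖z₀‖) (hρ : ‖q₀‖ + ε ≤ ρ) (hρ1 : ρ < 1)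
    (hZ : ‖z₀‖ + ε ≤ Z) (hMb : majorant ρ (8 * Z) ≤ Mb)
    (h0 : ‖wtheta (fun _ => 1) q₀ z₀‖ ≤ σ) (h0' : ‖wtheta id q₀ z₀‖ ≤ σ)
    (h1 : ‖wtheta tri q₀ z₀ - c₁‖ ≤ τ) (h2 : ‖wtheta (fun j => j * tri j) q₀ z₀ - c₂‖ ≤ τ)
    (h3 : ‖wtheta (fun j => j * j) q₀ z₀ - c₃‖ ≤ τ)
    (n1 : 2 * ‖q₀‖ ≤ ‖c₁‖) (n2 : ‖c₂‖ ≤ 14 * ‖q₀‖) (n3 : 9 / 50 * ‖z₀‖ ≤ ‖c₃‖)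
    (hc : 25 * Mb * ε + 5 * τ + σ ≤ 1 / 100) (hσ : 100 * σ ≤ ε) :
    (∃ q z, ‖q - q₀‖ ≤ ε ∧ ‖z - z₀‖ ≤ ε ∧ theta q z = 0 ∧ wtheta id q z = 0) ∧
    ∀ q q' z z', ‖q - q₀‖ ≤ ε → ‖q' - q₀‖ ≤ ε → ‖z - z₀‖ ≤ ε → ‖z' - z₀‖ ≤ ε →
      theta q z = 0 → wtheta id q z = 0 → theta q' z' = 0 → wtheta id q' z' = 0 →
      q = q' ∧ z = z' := by
  have hq0 : q₀ ≠ 0 := norm_pos_iff.mp (by linarith)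
  have hz0 : z₀ ≠ 0 := norm_pos_iff.mp (by linarith)
  have hq0' : 0 < ‖q₀‖ := by linarith
  have hz0' : 0 < ‖z₀‖ := by linarith
  have hσ0 : 0 ≤ σ := (norm_nonneg _).trans h0
  have hτ0 : 0 ≤ τ := (norm_nonneg _).trans h1
  have bq : ∀ q, ‖q - q₀‖ ≤ ε → ‖q‖ ≤ ρ := fun q hq => by
    have := norm_add_le (q - q₀) q₀
    rw [sub_add_cancel] at this; linarith
  have bz : ∀ z, ‖z - z₀‖ ≤ ε → ‖z‖ ≤ Z := fun z hz => by
    have := norm_add_le (z - z₀) z₀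
    rw [sub_add_cancel] at this; linarith
  -- Error budget: `25 * Mb * ε` from nonlinearity, `4 * τ` from replacing the `q`-derivative (as
  -- `‖q₀‖ ≥ 1/4`), and `τ + σ` from replacing the `z`-derivative.
  have key : ∀ p : ℕ → ℕ, (∀ j, p j ≤ 2 ^ j) → ∀ a b : ℂ,
      ‖wtheta (fun j => p j * tri j) q₀ z₀ - a‖ ≤ τ →
      ‖wtheta (fun j => p j * j) q₀ z₀ - b‖ ≤ τ + σ →
      ∀ q q' z z', ‖q - q₀‖ ≤ ε → ‖q' - q₀‖ ≤ ε → ‖z - z₀‖ ≤ ε → ‖z' - z₀‖ ≤ ε →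
      ‖wtheta p q z - wtheta p q' z' - (a / q₀ * (q - q') + b / z₀ * (z - z'))‖
        ≤ 1 / 100 * max ‖q - q'‖ ‖z - z'‖ := by
    intro p hp a b ha hb q q' z z' e1 e2 e3 e4
    set d := max ‖q - q'‖ ‖z - z'‖ with hd
    have hd0 : 0 ≤ d := le_max_of_le_left (norm_nonneg _)
    have w := norm_wtheta_sub_le (ρ := ρ) (Z := Z) (d := d) hp hq0 hz0 (by linarith) hρ1
      (by linarith) (bq q e1) (bq q' e2) (by linarith) (bz z e3) (bz z' e4) (by linarith) e1 e2 e3 e4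
      (le_max_left _ _) (le_max_right _ _)
    have w1 : ‖(wtheta (fun j => p j * tri j) q₀ z₀ - a) / q₀ * (q - q')‖ ≤ 4 * τ * d := by
      rw [norm_mul, norm_div]
      have : ‖wtheta (fun j => p j * tri j) q₀ z₀ - a‖ / ‖q₀‖ ≤ 4 * τ := by
        rw [div_le_iff₀ hq0']; nlinarith
      gcongr
      exact le_max_left _ _
    have w2 : ‖(wtheta (fun j => p j * j) q₀ z₀ - b) / z₀ * (z - z')‖ ≤ (τ + σ) * d := by
      rw [norm_mul, norm_div]
      have : ‖wtheta (fun j => p j * j) q₀ z₀ - b‖ / ‖z₀‖ ≤ τ + σ := by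
        rw [div_le_iff₀ hz0']; nlinarith
      gcongr
      exact le_max_right _ _
    have e : wtheta p q z - wtheta p q' z' - (a / q₀ * (q - q') + b / z₀ * (z - z'))
        = (wtheta p q z - wtheta p q' z' - (wtheta (fun j => p j * tri j) q₀ z₀ / q₀ * (q - q')
          + wtheta (fun j => p j * j) q₀ z₀ / z₀ * (z - z')))
          + (wtheta (fun j => p j * tri j) q₀ z₀ - a) / q₀ * (q - q')
          + (wtheta (fun j => p j * j) q₀ z₀ - b) / z₀ * (z - z') := by ring
    rw [e]
    refine (norm_add_le_of_le (norm_add_le_of_le w w1) w2).trans ?_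
    have hM : 25 * majorant ρ (8 * Z) * ε * d ≤ 25 * Mb * ε * d := by gcongr
    nlinarith
  have hA : 2 ≤ ‖c₁ / q₀‖ := by rw [norm_div, le_div_iff₀ hq0']; exact n1
  have hC : ‖c₂ / q₀‖ ≤ 14 := by rw [norm_div, div_le_iff₀ hq0']; exact n2
  have hE : 9 / 50 ≤ ‖c₃ / z₀‖ := by rw [norm_div, le_div_iff₀ hz0']; exact n3
  -- Here `7 = 14 / 2`. The contraction condition becomes `1/100 + 7/100 ≤ (9/50) / 2`.
  have quot : ∀ t : ℝ, 0 ≤ t → ‖c₂ / q₀‖ * t / ‖c₁ / q₀‖ ≤ 7 * t := by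
    intro t ht
    rw [div_le_iff₀ (by linarith)]
    nlinarith
  refine exists_unique_zero_of_approx (f := theta) (g := wtheta id) (A := c₁ / q₀) (C := c₂ / q₀)
    (E := c₃ / z₀) (c := 1 / 100) (c' := 1 / 100) hε (norm_pos_iff.mp (by linarith))
    (norm_pos_iff.mp (by linarith)) ?_ ?_ (by linarith) ?_ ?_ ?_
  · intro q q' z z' e1 e2 e3 e4
    have h1' : ‖wtheta (fun j => 1 * tri j) q₀ z₀ - c₁‖ ≤ τ := by simpa only [one_mul] using h1
    -- The entry `∂_z θ` of the Jacobian is replaced by zero, at the cost of the residual `σ`. This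
    -- makes the Jacobian triangular.
    have h0'' : ‖wtheta (fun j => 1 * j) q₀ z₀ - 0‖ ≤ τ + σ := by
      simp only [one_mul, sub_zero]
      exact h0'.trans (by linarith)
    have := key (fun _ => 1) (fun j => Nat.one_le_two_pow) c₁ 0 h1' h0'' q q' z z' e1 e2 e3 e4
    simpa [theta_eq_wtheta] using this
  · intro q q' z z' e1 e2 e3 e4
    exact key id nat_le_two_pow c₂ c₃ h2 (h3.trans (by linarith)) q q' z z' e1 e2 e3 e4
  · have := quot (1 / 100) (by norm_num)
    linarith
  · rw [theta_eq_wtheta]; nlinarith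
  · rw [theta_eq_wtheta]
    have := quot _ (norm_nonneg (wtheta (fun _ => 1) q₀ z₀))
    nlinarith

/-- A quantitative criterion for the existence of a zero of `θ(q, ·)` for `q` near `q₀`. -/
lemma exists_zero_near {q₀ z₀ c₁ c₃ : ℂ} {ρ Z Mb ε τ σ : ℝ}
    (hε : 0 < ε) (hq₀ : 1 / 4 ≤ ‖q₀‖) (hz₀ : 1 ≤ ‖z₀‖) (hρ : ‖q₀‖ + ε ≤ ρ) (hρ1 : ρ < 1)
    (hZ : ‖z₀‖ + ε ≤ Z) (hMb : majorant ρ (8 * Z) ≤ Mb)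
    (h0 : ‖wtheta (fun _ => 1) q₀ z₀‖ ≤ σ)
    (h1 : ‖wtheta tri q₀ z₀ - c₁‖ ≤ τ) (h3 : ‖wtheta id q₀ z₀ - c₃‖ ≤ τ)
    (n1 : ‖c₁‖ ≤ 4 * ‖q₀‖) (n3 : 9 / 50 * ‖z₀‖ ≤ ‖c₃‖)
    (hc : 25 * Mb * ε + 5 * τ ≤ 1 / 100) (hσ : 100 * σ ≤ ε) {q : ℂ} (hq : ‖q - q₀‖ ≤ ε / 100) :
    ∃ z, ‖z - z₀‖ ≤ ε ∧ theta q z = 0 := by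
  have hq0 : q₀ ≠ 0 := norm_pos_iff.mp (by linarith)
  have hz0 : z₀ ≠ 0 := norm_pos_iff.mp (by linarith)
  have hq0' : 0 < ‖q₀‖ := by linarith
  have hz0' : 0 < ‖z₀‖ := by linarith
  have hτ0 : 0 ≤ τ := (norm_nonneg _).trans h1
  have hC : ‖c₁ / q₀‖ ≤ 4 := by rw [norm_div, div_le_iff₀ hq0']; exact n1
  have hE : 9 / 50 ≤ ‖c₃ / z₀‖ := by rw [norm_div, le_div_iff₀ hz0']; exact n3
  have bq : ∀ q, ‖q - q₀‖ ≤ ε → ‖q‖ ≤ ρ := fun q hq => by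
    have := norm_add_le (q - q₀) q₀
    rw [sub_add_cancel] at this; linarith
  have bz : ∀ z, ‖z - z₀‖ ≤ ε → ‖z‖ ≤ Z := fun z hz => by
    have := norm_add_le (z - z₀) z₀
    rw [sub_add_cancel] at this; linarith
  -- The two-variable Newton lemma with the trivial first equation `x = q`. The initial residual of
  -- that equation is `‖q₀ - q‖`, hence the requirement that it be small compared with `ε`.
  obtain ⟨⟨x, z, -, hz, hx, hxz⟩, -⟩ := exists_unique_zero_of_approx (f := fun x _ => x - q)
    (g := theta) (x₀ := q₀) (y₀ := z₀) (A := 1) (C := c₁ / q₀)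
    (E := c₃ / z₀) (c := 0) (c' := 1 / 100) hε one_ne_zero
    (norm_pos_iff.mp (by linarith)) (fun x x' y y' _ _ _ _ => by simp) (by
      intro q q' z z' e1 e2 e3 e4
      set d := max ‖q - q'‖ ‖z - z'‖ with hd
      have hd0 : 0 ≤ d := le_max_of_le_left (norm_nonneg _)
      have w := norm_wtheta_sub_le (p := fun _ => 1) (ρ := ρ) (Z := Z) (d := d)
        (fun j => Nat.one_le_two_pow) hq0 hz0 (by linarith) hρ1
        (by linarith) (bq q e1) (bq q' e2) (by linarith) (bz z e3) (bz z' e4) (by linarith)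
        e1 e2 e3 e4 (le_max_left _ _) (le_max_right _ _)
      simp only [one_mul] at w
      change ‖wtheta id q₀ z₀ - c₃‖ ≤ τ at h3
      have w1 : ‖(wtheta (fun j => tri j) q₀ z₀ - c₁) / q₀ * (q - q')‖ ≤ 4 * τ * d := by
        rw [norm_mul, norm_div]
        have : ‖wtheta (fun j => tri j) q₀ z₀ - c₁‖ / ‖q₀‖ ≤ 4 * τ := by
          rw [div_le_iff₀ hq0']
          change ‖wtheta tri q₀ z₀ - c₁‖ ≤ _
          nlinarith
        gcongr
        exact le_max_left _ _
      have w2 : ‖(wtheta (fun j => j) q₀ z₀ - c₃) / z₀ * (z - z')‖ ≤ τ * d := by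
        rw [norm_mul, norm_div]
        have : ‖wtheta (fun j => j) q₀ z₀ - c₃‖ / ‖z₀‖ ≤ τ := by
          rw [div_le_iff₀ hz0']
          change ‖wtheta id q₀ z₀ - c₃‖ ≤ _
          nlinarith
        gcongr
        exact le_max_right _ _
      have e : theta q z - theta q' z' - (c₁ / q₀ * (q - q') + c₃ / z₀ * (z - z'))
          = (wtheta (fun _ => 1) q z - wtheta (fun _ => 1) q' z'
            - (wtheta (fun j => tri j) q₀ z₀ / q₀ * (q - q')
            + wtheta (fun j => j) q₀ z₀ / z₀ * (z - z')))
            + (wtheta (fun j => tri j) q₀ z₀ - c₁) / q₀ * (q - q')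
            + (wtheta (fun j => j) q₀ z₀ - c₃) / z₀ * (z - z') := by
        rw [theta_eq_wtheta, theta_eq_wtheta]; ring
      rw [e]
      refine (norm_add_le_of_le (norm_add_le_of_le w w1) w2).trans ?_
      have hM : 25 * majorant ρ (8 * Z) * ε * d ≤ 25 * Mb * ε * d := by gcongr
      nlinarith)
    (by simp) (by rw [mul_zero, zero_div]; linarith) (by
      rw [norm_sub_rev] at hq; simp; linarith) (by
      rw [norm_sub_rev] at hq
      rw [theta_eq_wtheta, norm_one, div_one]
      have : ‖c₁ / q₀‖ * ‖q₀ - q‖ ≤ 4 * (ε / 100) := by gcongr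
      nlinarith)
  rw [sub_eq_zero.mp hx] at hxz
  exact ⟨z, hz, hxz⟩


/-! ### Certified approximations of the spectral values and of the corresponding zeros -/

lemma norm_toComplex_div_le {g : GaussianInt} {t D : ℕ} {x : ℝ} (h : g.norm ≤ t ^ 2)
    (hD : D ≠ 0) (hx : t / D ≤ x) : ‖GaussianInt.toComplex g / D‖ ≤ x := by
  have : (0 : ℝ) < D := by positivity
  refine le_trans ?_ hx
  rw [norm_div, Complex.norm_natCast]
  gcongr
  exact norm_toComplex_le h

lemma le_norm_toComplex_div {g : GaussianInt} {t D : ℕ} {x : ℝ} (h : (t : ℤ) ^ 2 ≤ g.norm)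
    (hD : D ≠ 0) (hx : x ≤ t / D) : x ≤ ‖GaussianInt.toComplex g / D‖ := by
  have : (0 : ℝ) < D := by positivity
  refine hx.trans ?_
  rw [norm_div, Complex.norm_natCast]
  gcongr
  exact le_norm_toComplex h

/-- `10 ^ 30` times the real spectral value, rounded. -/
def qNum : GaussianInt := ⟨309249338600077480027483387771, 0⟩
/-- `10 ^ 30` times the double zero for the real spectral value, rounded. -/
def xNum : GaussianInt := ⟨-7503255964244192365654314568089, 0⟩
/-- `10 ^ 30` times the complex spectral value, rounded. -/
def vNum : GaussianInt := ⟨435318495824486417208145250320, 123044008551949111056353863228⟩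
/-- `10 ^ 30` times the double zero for the complex spectral value, rounded. -/
def bNum : GaussianInt := ⟨-5963923719619594758575657865131, 6104775174235744135358776376650⟩
/-- `10 ^ 30` times the small simple zero for the complex spectral value, rounded. -/
def aNum : GaussianInt := ⟨-3277944070485825640703771689294, -1483075310619733745012966222358⟩

/-- The complex number `g / 10 ^ 30`. -/
noncomputable def scaled (g : GaussianInt) : ℂ := GaussianInt.toComplex g / (10 ^ 30 : ℕ)

lemma norm_scaled_le {g : GaussianInt} (t : ℕ) {x : ℝ} (h : g.norm ≤ t ^ 2)
    (hx : (t : ℝ) / (10 ^ 30 : ℕ) ≤ x) : ‖scaled g‖ ≤ x :=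
  norm_toComplex_div_le h (by norm_num) hx

lemma le_norm_scaled {g : GaussianInt} (t : ℕ) {x : ℝ} (h : (t : ℤ) ^ 2 ≤ g.norm)
    (hx : x ≤ (t : ℝ) / (10 ^ 30 : ℕ)) : x ≤ ‖scaled g‖ :=
  le_norm_toComplex_div h (by norm_num) hx

lemma scaled_re (g : GaussianInt) : (scaled g).re = g.re / 10 ^ 30 := by
  rw [scaled, Complex.div_natCast_re]; norm_num

lemma scaled_im (g : GaussianInt) : (scaled g).im = g.im / 10 ^ 30 := by
  rw [scaled, Complex.div_natCast_im]; norm_num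

/-- The bounds `0.4524` and `8.6` serve all three approximate pairs `(q, z)`. Keeping the terms `j ≤
16` leaves a tail governed by `0.4524 ^ 153`, below `10 ^ (-25)`. -/
lemma norm_wtheta_scaled_sub_le {p : ℕ → ℕ} (hp : ∀ j, p j ≤ 4 ^ j) {A B c : GaussianInt}
    (hA : ‖scaled A‖ ≤ 4524 / 10000) (hB : ‖scaled B‖ ≤ 86 / 10) {K L : ℕ} (hK : K ≠ 0)
    (hL : L ≠ 0) {δ : ℝ} (hδ : 1 / L + 1 / 10 ^ 25 ≤ δ)
    (h : (hornerNum p A B (10 ^ 30) 16 0 * K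
      - c * ((10 ^ 30 : ℕ) : GaussianInt) ^ hornerExp 16 0).norm * L ^ 2
      ≤ (K * ((10 ^ 30 : ℕ) : ℤ) ^ hornerExp 16 0) ^ 2) :
    ‖wtheta p (scaled A) (scaled B) - GaussianInt.toComplex c / K‖ ≤ δ := by
  refine norm_wtheta_sub_le_of_hornerNum (n := 16) hp (by norm_num) hK hL hA (by norm_num) hB
    (by norm_num) (le_trans ?_ hδ) h
  have : tri 17 = 153 := by decide
  norm_num [this]

lemma norm_wtheta_scaled_le {p : ℕ → ℕ} (hp : ∀ j, p j ≤ 4 ^ j) {A B : GaussianInt}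
    (hA : ‖scaled A‖ ≤ 4524 / 10000) (hB : ‖scaled B‖ ≤ 86 / 10)
    (h : (hornerNum p A B (10 ^ 30) 16 0 * (1 : ℕ)
      - 0 * ((10 ^ 30 : ℕ) : GaussianInt) ^ hornerExp 16 0).norm * (10 ^ 21 : ℕ) ^ 2
      ≤ ((1 : ℕ) * ((10 ^ 30 : ℕ) : ℤ) ^ hornerExp 16 0) ^ 2) :
    ‖wtheta p (scaled A) (scaled B)‖ ≤ 1 / 10 ^ 20 := by
  have := norm_wtheta_scaled_sub_le (c := 0) (δ := 1 / 10 ^ 20) hp hA hB one_ne_zero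
    (by norm_num : 10 ^ 21 ≠ 0) (by norm_num) h
  rwa [map_zero, zero_div, sub_zero] at this

lemma majorant_numeric_le : majorant (4524 / 10000) (8 * (862 / 100)) ≤ 10 ^ 6 := by
  refine (majorant_le (by norm_num) (by norm_num) (by norm_num) 8 (by norm_num)).trans ?_
  have : tri 1 = 1 ∧ tri 2 = 3 ∧ tri 3 = 6 ∧ tri 4 = 10 ∧ tri 5 = 15 ∧ tri 6 = 21 ∧ tri 7 = 28 ∧
    tri 8 = 36 := by decide
  norm_num [Finset.sum_range_succ, this, tri_zero]

lemma mul_le_four_pow {a b : ℕ → ℕ} (ha : ∀ j, a j ≤ 2 ^ j) (hb : ∀ j, b j ≤ 2 ^ j) (j : ℕ) :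
    a j * b j ≤ 4 ^ j :=
  (Nat.mul_le_mul (ha j) (hb j)).trans_eq (by rw [← mul_pow]; norm_num)

lemma le_four_pow {a : ℕ → ℕ} (ha : ∀ j, a j ≤ 2 ^ j) (j : ℕ) : a j ≤ 4 ^ j :=
  (ha j).trans (Nat.pow_le_pow_left (by norm_num) j)

lemma norm_qNum_le : ‖scaled qNum‖ ≤ 3093 / 10000 :=
  norm_scaled_le (309249338600077480027483387771) (by decide +kernel) (by norm_num)

lemma le_norm_qNum : 3092 / 10000 ≤ ‖scaled qNum‖ :=
  le_norm_scaled (309249338600077480027483387771) (by decide +kernel) (by norm_num)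

lemma norm_xNum_le : ‖scaled xNum‖ ≤ 751 / 100 :=
  norm_scaled_le (7503255964244192365654314568089) (by decide +kernel) (by norm_num)

lemma le_norm_xNum : 750 / 100 ≤ ‖scaled xNum‖ :=
  le_norm_scaled (7503255964244192365654314568089) (by decide +kernel) (by norm_num)

lemma norm_vNum_le : ‖scaled vNum‖ ≤ 45238 / 100000 :=
  norm_scaled_le (45238 * 10 ^ 25) (by decide +kernel) (by norm_num)

lemma le_norm_vNum : 45237 / 100000 ≤ ‖scaled vNum‖ :=
  le_norm_scaled (45237 * 10 ^ 25) (by decide +kernel) (by norm_num)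

lemma norm_bNum_le : ‖scaled bNum‖ ≤ 854 / 100 :=
  norm_scaled_le (854 * 10 ^ 28) (by decide +kernel) (by norm_num)

lemma le_norm_bNum : 853 / 100 ≤ ‖scaled bNum‖ :=
  le_norm_scaled (853 * 10 ^ 28) (by decide +kernel) (by norm_num)

lemma norm_aNum_le : ‖scaled aNum‖ ≤ 360 / 100 :=
  norm_scaled_le (360 * 10 ^ 28) (by decide +kernel) (by norm_num)

lemma le_norm_aNum : 359 / 100 ≤ ‖scaled aNum‖ :=
  le_norm_scaled (359 * 10 ^ 28) (by decide +kernel) (by norm_num)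

lemma exists_unique_real_double_zero :
    (∃ q z, ‖q - scaled qNum‖ ≤ 1 / 10 ^ 18 ∧ ‖z - scaled xNum‖ ≤ 1 / 10 ^ 18 ∧
      theta q z = 0 ∧ wtheta id q z = 0) ∧
    ∀ q q' z z', ‖q - scaled qNum‖ ≤ 1 / 10 ^ 18 → ‖q' - scaled qNum‖ ≤ 1 / 10 ^ 18 →
      ‖z - scaled xNum‖ ≤ 1 / 10 ^ 18 → ‖z' - scaled xNum‖ ≤ 1 / 10 ^ 18 →
      theta q z = 0 → wtheta id q z = 0 → theta q' z' = 0 → wtheta id q' z' = 0 →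
      q = q' ∧ z = z' := by
  have hA : ‖scaled qNum‖ ≤ 4524 / 10000 := norm_qNum_le.trans (by norm_num)
  have hB : ‖scaled xNum‖ ≤ 86 / 10 := norm_xNum_le.trans (by norm_num)
  have a1 := le_norm_qNum
  have a2 := norm_qNum_le
  have a3 := le_norm_xNum
  have a4 := norm_xNum_le
  refine exists_unique_double_zero (ρ := 4524 / 10000) (Z := 862 / 100) (Mb := 10 ^ 6)
    (τ := 1 / 1000) (σ := 1 / 10 ^ 20)
    -- Four-decimal values of `q ∂_q θ`, `q ∂_q (z ∂_z θ)` and `(z ∂_z)² θ`. Since `2 * tri j = j ^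
    -- 2 + j`, the third is twice the first at a double zero.
    (c₁ := GaussianInt.toComplex ⟨7034, 0⟩ / (10 ^ 4 : ℕ))
    (c₂ := GaussianInt.toComplex ⟨19934, 0⟩ / (10 ^ 4 : ℕ))
    (c₃ := GaussianInt.toComplex ⟨14068, 0⟩ / (10 ^ 4 : ℕ))
    (by norm_num) (by linarith) (by linarith) (by linarith) (by norm_num) (by linarith)
    majorant_numeric_le
    (norm_wtheta_scaled_le (le_four_pow fun _ => Nat.one_le_two_pow) hA hB (by decide +kernel))
    (norm_wtheta_scaled_le (le_four_pow nat_le_two_pow) hA hB (by decide +kernel))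
    (norm_wtheta_scaled_sub_le (le_four_pow tri_le_two_pow) hA hB (by norm_num)
      (by norm_num : 2000 ≠ 0) (by norm_num) (by decide +kernel))
    (norm_wtheta_scaled_sub_le (mul_le_four_pow nat_le_two_pow tri_le_two_pow) hA hB (by norm_num)
      (by norm_num : 2000 ≠ 0) (by norm_num) (by decide +kernel))
    (norm_wtheta_scaled_sub_le (mul_le_four_pow nat_le_two_pow nat_le_two_pow) hA hB (by norm_num)
      (by norm_num : 2000 ≠ 0) (by norm_num) (by decide +kernel))
    ?_ ?_ ?_ (by norm_num) (by norm_num)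
  · have := le_norm_toComplex_div (g := ⟨7034, 0⟩) (t := 7000) (D := 10 ^ 4) (x := 7 / 10)
      (by decide +kernel) (by norm_num) (by norm_num)
    linarith
  · have := norm_toComplex_div_le (g := ⟨19934, 0⟩) (t := 20000) (D := 10 ^ 4) (x := 2)
      (by decide +kernel) (by norm_num) (by norm_num)
    linarith
  · have := le_norm_toComplex_div (g := ⟨14068, 0⟩) (t := 14000) (D := 10 ^ 4) (x := 14 / 10)
      (by decide +kernel) (by norm_num) (by norm_num)
    linarith

lemma exists_complex_double_zero :
    ∃ v b, ‖v - scaled vNum‖ ≤ 1 / 10 ^ 18 ∧ ‖b - scaled bNum‖ ≤ 1 / 10 ^ 18 ∧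
      theta v b = 0 ∧ wtheta id v b = 0 := by
  have hA : ‖scaled vNum‖ ≤ 4524 / 10000 := norm_vNum_le.trans (by norm_num)
  have hB : ‖scaled bNum‖ ≤ 86 / 10 := norm_bNum_le.trans (by norm_num)
  have a1 := le_norm_vNum
  have a2 := norm_vNum_le
  have a3 := le_norm_bNum
  have a4 := norm_bNum_le
  refine (exists_unique_double_zero (ρ := 4524 / 10000) (Z := 862 / 100) (Mb := 10 ^ 6)
    (τ := 1 / 1000) (σ := 1 / 10 ^ 20)
    (c₁ := GaussianInt.toComplex ⟨5434, 10963⟩ / (10 ^ 4 : ℕ))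
    (c₂ := GaussianInt.toComplex ⟨27190, 52651⟩ / (10 ^ 4 : ℕ))
    (c₃ := GaussianInt.toComplex ⟨10868, 21925⟩ / (10 ^ 4 : ℕ))
    (by norm_num) (by linarith) (by linarith) (by linarith) (by norm_num) (by linarith)
    majorant_numeric_le
    (norm_wtheta_scaled_le (le_four_pow fun _ => Nat.one_le_two_pow) hA hB (by decide +kernel))
    (norm_wtheta_scaled_le (le_four_pow nat_le_two_pow) hA hB (by decide +kernel))
    (norm_wtheta_scaled_sub_le (le_four_pow tri_le_two_pow) hA hB (by norm_num)
      (by norm_num : 2000 ≠ 0) (by norm_num) (by decide +kernel))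
    (norm_wtheta_scaled_sub_le (mul_le_four_pow nat_le_two_pow tri_le_two_pow) hA hB (by norm_num)
      (by norm_num : 2000 ≠ 0) (by norm_num) (by decide +kernel))
    (norm_wtheta_scaled_sub_le (mul_le_four_pow nat_le_two_pow nat_le_two_pow) hA hB (by norm_num)
      (by norm_num : 2000 ≠ 0) (by norm_num) (by decide +kernel))
    ?_ ?_ ?_ (by norm_num) (by norm_num)).1
  · have := le_norm_toComplex_div (g := ⟨5434, 10963⟩) (t := 12000) (D := 10 ^ 4) (x := 12 / 10)
      (by decide +kernel) (by norm_num) (by norm_num)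
    linarith
  · have := norm_toComplex_div_le (g := ⟨27190, 52651⟩) (t := 60000) (D := 10 ^ 4) (x := 6)
      (by decide +kernel) (by norm_num) (by norm_num)
    linarith
  · have := le_norm_toComplex_div (g := ⟨10868, 21925⟩) (t := 20000) (D := 10 ^ 4) (x := 2)
      (by decide +kernel) (by norm_num) (by norm_num)
    linarith

lemma exists_complex_simple_zero {v : ℂ} (hv : ‖v - scaled vNum‖ ≤ 1 / 10 ^ 18) :
    ∃ a, ‖a - scaled aNum‖ ≤ 1 / 10 ^ 16 ∧ theta v a = 0 := by
  have hA : ‖scaled vNum‖ ≤ 4524 / 10000 := norm_vNum_le.trans (by norm_num)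
  have hB : ‖scaled aNum‖ ≤ 86 / 10 := norm_aNum_le.trans (by norm_num)
  have a1 := le_norm_vNum
  have a2 := norm_vNum_le
  have a3 := le_norm_aNum
  have a4 := norm_aNum_le
  refine exists_zero_near (ρ := 4524 / 10000) (Z := 862 / 100) (Mb := 10 ^ 6)
    (τ := 1 / 1000) (σ := 1 / 10 ^ 20)
    (c₁ := GaussianInt.toComplex ⟨5013, 14398⟩ / (10 ^ 4 : ℕ))
    (c₃ := GaussianInt.toComplex ⟨-4088, 8486⟩ / (10 ^ 4 : ℕ))
    (by norm_num) (by linarith) (by linarith) (by linarith) (by norm_num) (by linarith)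
    majorant_numeric_le
    (norm_wtheta_scaled_le (le_four_pow fun _ => Nat.one_le_two_pow) hA hB (by decide +kernel))
    (norm_wtheta_scaled_sub_le (le_four_pow tri_le_two_pow) hA hB (by norm_num)
      (by norm_num : 2000 ≠ 0) (by norm_num) (by decide +kernel))
    (norm_wtheta_scaled_sub_le (le_four_pow nat_le_two_pow) hA hB (by norm_num)
      (by norm_num : 2000 ≠ 0) (by norm_num) (by decide +kernel))
    -- With `ε = 10 ^ (-16)`, the accuracy `10 ^ (-18)` of `v` is exactly the permitted `ε / 100`.
    ?_ ?_ (by norm_num) (by norm_num) (hv.trans (by norm_num))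
  · have := norm_toComplex_div_le (g := ⟨5013, 14398⟩) (t := 16000) (D := 10 ^ 4) (x := 16 / 10)
      (by decide +kernel) (by norm_num) (by norm_num)
    linarith
  · have := le_norm_toComplex_div (g := ⟨-4088, 8486⟩) (t := 9000) (D := 10 ^ 4) (x := 9 / 10)
      (by decide +kernel) (by norm_num) (by norm_num)
    linarith


/-! ### The Jacobi triple product -/

/-- The finite product `(1 - q) ⋯ (1 - q ^ n)`. -/
noncomputable def qfact (q : ℂ) (n : ℕ) : ℂ := ∏ l ∈ Finset.range n, (1 - q ^ (l + 1))

lemma one_sub_pow_ne_zero {q : ℂ} (hq : ‖q‖ < 1) (n : ℕ) : 1 - q ^ (n + 1) ≠ 0 := by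
  intro h
  have : ‖q‖ ^ (n + 1) = 1 := by rw [← norm_pow, ← sub_eq_zero.mp h, norm_one]
  exact (pow_lt_one₀ (norm_nonneg q) hq n.succ_ne_zero).ne this

lemma exists_tendsto_qfact {q : ℂ} (hq : ‖q‖ < 1) :
    ∃ L : ℂ, L ≠ 0 ∧ Tendsto (qfact q) atTop (𝓝 L) := by
  have hs : Summable fun l : ℕ => ‖-q ^ (l + 1)‖ := by
    simp only [norm_neg, norm_mul, norm_pow, pow_succ]
    exact (summable_geometric_of_lt_one (norm_nonneg q) hq).mul_right _
  refine ⟨∏' l : ℕ, (1 + -q ^ (l + 1)), tprod_one_add_ne_zero_of_summable (fun l => ?_) hs, ?_⟩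
  · rw [← sub_eq_add_neg]; exact one_sub_pow_ne_zero hq l
  · have := (multipliable_one_add_of_summable hs).tendsto_prod_tprod_nat
    refine this.congr fun n => Finset.prod_congr rfl fun l _ => (sub_eq_add_neg _ _).symm

/-- The reciprocal of `qfact`, extended by zero to negative integers. -/
noncomputable def invQfact (q : ℂ) (k : ℤ) : ℂ := if 0 ≤ k then (qfact q k.toNat)⁻¹ else 0

/-- The extension by zero to negative integers is the one compatible with this recurrence, because
`1 - q ^ k` vanishes at `k = 0`. It allows sums over all of `ℤ` without boundary cases. -/
lemma invQfact_pred {q : ℂ} (hq : ‖q‖ < 1) (k : ℤ) :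
    invQfact q (k - 1) = (1 - q ^ k) * invQfact q k := by
  rcases lt_trichotomy k 0 with h | rfl | h
  · rw [invQfact, invQfact, if_neg (by omega), if_neg (by omega), mul_zero]
  · simp [invQfact]
  · obtain ⟨n, rfl⟩ : ∃ n : ℕ, k = n + 1 := ⟨(k - 1).toNat, by omega⟩
    have h1 : (0 : ℤ) ≤ (n : ℤ) + 1 := by omega
    have h2 : ((n : ℤ) + 1).toNat = n + 1 := by omega
    rw [invQfact, invQfact, add_sub_cancel_right, if_pos (Int.natCast_nonneg n), if_pos h1, h2,
      Int.toNat_natCast, qfact, qfact, Finset.prod_range_succ, mul_inv,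
      show (n : ℤ) + 1 = ((n + 1 : ℕ) : ℤ) by push_cast; rfl, zpow_natCast]
    have := one_sub_pow_ne_zero hq n
    field_simp

/-- The triangular numbers of integers. -/
def triInt (m : ℤ) : ℤ := m * (m + 1) / 2

lemma triInt_succ (m : ℤ) : triInt (m + 1) = triInt m + (m + 1) := by
  unfold triInt
  rw [show (m + 1) * (m + 1 + 1) = m * (m + 1) + (m + 1) * 2 by ring,
    Int.add_mul_ediv_right _ _ (by norm_num)]

lemma triInt_natCast (n : ℕ) : triInt n = tri n := by
  unfold triInt tri; push_cast; rfl

lemma triInt_neg (n : ℕ) : triInt (-(n + 1)) = tri n := by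
  rw [← triInt_natCast]; unfold triInt; congr 1; ring

/-- The terms of the full theta series. -/
noncomputable def thetaTerm (q z : ℂ) (m : ℤ) : ℂ := q ^ triInt m * z ^ m

lemma mul_thetaTerm_pred {q z : ℂ} (hq : q ≠ 0) (hz : z ≠ 0) (m : ℤ) :
    z * thetaTerm q z (m - 1) = q ^ (-m) * thetaTerm q z m := by
  have h := triInt_succ (m - 1)
  rw [sub_add_cancel] at h
  rw [thetaTerm, thetaTerm, h, zpow_add₀ hq, zpow_sub₀ hz, zpow_neg, zpow_one]
  have := zpow_ne_zero m hq
  field_simp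

lemma thetaTerm_succ_div {q z : ℂ} (hq : q ≠ 0) (hz : z ≠ 0) (m : ℤ) :
    z⁻¹ * thetaTerm q z (m + 1) = q ^ (m + 1) * thetaTerm q z m := by
  rw [thetaTerm, thetaTerm, triInt_succ, zpow_add₀ hq, zpow_add₀ hz, zpow_one]
  field_simp

/-- The full theta function `∑_{j ∈ ℤ} q ^ (j (j + 1) / 2) z ^ j`, written by means of the partial
theta function. -/
noncomputable def fullTheta (q z : ℂ) : ℂ := theta q z + z⁻¹ * theta q z⁻¹

/-- Triangular numbers are invariant under `m ↦ -m - 1`, so the negative half of the series is again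
a partial theta series, at `z⁻¹`. -/
lemma hasSum_thetaTerm {q : ℂ} (hq : ‖q‖ < 1) (z : ℂ) :
    HasSum (thetaTerm q z) (fullTheta q z) := by
  refine HasSum.of_nat_of_neg_add_one ?_ ?_
  · have : (fun n : ℕ => thetaTerm q z n) = fun n : ℕ => q ^ tri n * z ^ n := by
      funext n; rw [thetaTerm, triInt_natCast, zpow_natCast, zpow_natCast]
    rw [this]
    exact (summable_theta hq z).hasSum
  · have : (fun n : ℕ => thetaTerm q z (-(n + 1))) = fun n : ℕ => z⁻¹ * (q ^ tri n * z⁻¹ ^ n) := by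
      funext n
      rw [thetaTerm, triInt_neg, zpow_natCast, zpow_neg,
        show (n : ℤ) + 1 = ((n + 1 : ℕ) : ℤ) by push_cast; rfl, zpow_natCast, pow_succ, mul_inv,
        inv_pow]
      ring
    rw [this]
    exact (summable_theta hq z⁻¹).hasSum.mul_left _

lemma summable_norm_thetaTerm {q : ℂ} (hq : ‖q‖ < 1) (z : ℂ) :
    Summable fun m => ‖thetaTerm q z m‖ := (hasSum_thetaTerm hq z).summable.norm

/-- The finite form of the Jacobi triple product. -/
lemma hasSum_finite_triple_product {q z : ℂ} (hq : ‖q‖ < 1) (hq0 : q ≠ 0) (hz : z ≠ 0) (n : ℕ) :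
    HasSum (fun m : ℤ => qfact q (2 * n) * invQfact q (n + m) * invQfact q (n - m)
      * thetaTerm q z m) (∏ l ∈ Finset.range n, ((1 + z * q ^ (l + 1)) * (1 + q ^ l / z))) := by
  induction n with
  | zero =>
    rw [Finset.prod_range_zero]
    refine (Eq.subst (motive := fun f => HasSum f (1 : ℂ)) (funext fun m => Eq.symm ?_) (hasSum_ite_eq (0 : ℤ) (1 : ℂ)))
    split_ifs with hm
    · subst hm; simp [qfact, invQfact, thetaTerm, triInt]
    · rcases lt_or_gt_of_ne hm with h | h
      · simp [invQfact, not_le.mpr h]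
      · simp [invQfact, not_le.mpr h]
  | succ n ih =>
    -- The new factor expands to `1 + q ^ (2 n + 1) + q ^ (n + 1) z + q ^ n z⁻¹`. Multiplication by
    -- `z` and `z⁻¹` shifts the index, and comparing coefficients leaves a recurrence for the
    -- `q`-binomial coefficients.
    have h1 := ((Equiv.subRight (1 : ℤ)).hasSum_iff.mpr ih).mul_left (q ^ (n + 1) * z)
    have h2 := ((Equiv.addRight (1 : ℤ)).hasSum_iff.mpr ih).mul_left (q ^ n * z⁻¹)
    have h := ((ih.mul_left (1 + q ^ (2 * n + 1))).add h1).add h2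
    rw [Finset.prod_range_succ]
    have hprod : ∀ P : ℂ, P * ((1 + z * q ^ (n + 1)) * (1 + q ^ n / z))
        = (1 + q ^ (2 * n + 1)) * P + q ^ (n + 1) * z * P + q ^ n * z⁻¹ * P := by
      intro P; field_simp; ring
    rw [hprod]
    refine Eq.subst (motive := fun f => HasSum f _) (funext fun m => Eq.symm ?_) h
    · simp only [Function.comp_apply, Equiv.coe_addRight, Equiv.subRight_apply]
      set X := invQfact q (n + 1 + m) with hX
      set Y := invQfact q (n + 1 - m) with hY
      set t := thetaTerm q z m with ht
      have i1 : invQfact q (n + m) = (1 - q ^ ((n : ℤ) + 1 + m)) * X := by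
        rw [hX, ← invQfact_pred hq]; congr 1; ring
      have i2 : invQfact q (n - m) = (1 - q ^ ((n : ℤ) + 1 - m)) * Y := by
        rw [hY, ← invQfact_pred hq]; congr 1; ring
      have i3 : invQfact q (n + (m - 1)) = (1 - q ^ ((n : ℤ) + m)) * invQfact q (n + m) := by
        rw [← invQfact_pred hq]; congr 1; ring
      have i4 : invQfact q (n - (m + 1)) = (1 - q ^ ((n : ℤ) - m)) * invQfact q (n - m) := by
        rw [← invQfact_pred hq]; congr 1; ring
      have i5 : invQfact q (n - (m - 1)) = Y := by rw [hY]; congr 1; ring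
      have i6 : invQfact q (n + (m + 1)) = X := by rw [hX]; congr 1; ring
      have t1 := mul_thetaTerm_pred hq0 hz m
      have t2 := thetaTerm_succ_div hq0 hz m
      have c1 : (((n + 1 : ℕ) : ℤ)) = (n : ℤ) + 1 := by push_cast; rfl
      have f : qfact q (2 * (n + 1)) = qfact q (2 * n) * (1 - q ^ (2 * n + 1))
          * (1 - q ^ (2 * n + 2)) := by
        rw [show 2 * (n + 1) = 2 * n + 1 + 1 by ring, qfact, Finset.prod_range_succ,
          Finset.prod_range_succ]; rfl
      rw [i3, i4, i5, i6, i1, i2, c1, ← hX, ← hY, f]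
      have s1 : q ^ (n + 1) * z * (qfact q (2 * n) * ((1 - q ^ ((n : ℤ) + m))
          * ((1 - q ^ ((n : ℤ) + 1 + m)) * X)) * Y * thetaTerm q z (m - 1))
          = q ^ (n + 1) * (qfact q (2 * n) * ((1 - q ^ ((n : ℤ) + m))
          * ((1 - q ^ ((n : ℤ) + 1 + m)) * X)) * Y) * (q ^ (-m) * t) := by
        rw [← t1]; ring
      have s2 : q ^ n * z⁻¹ * (qfact q (2 * n) * X * ((1 - q ^ ((n : ℤ) - m))
          * ((1 - q ^ ((n : ℤ) + 1 - m)) * Y)) * thetaTerm q z (m + 1))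
          = q ^ n * (qfact q (2 * n) * X * ((1 - q ^ ((n : ℤ) - m))
          * ((1 - q ^ ((n : ℤ) + 1 - m)) * Y))) * (q ^ (m + 1) * t) := by
        rw [← t2]; ring
      rw [s1, s2]
      have hm : q ^ m ≠ 0 := zpow_ne_zero m hq0
      simp only [zpow_add₀ hq0, zpow_sub₀ hq0, zpow_neg, zpow_natCast, zpow_one]
      field_simp
      ring

/-- Reciprocals of a sequence with nonzero limit are bounded. This supplies the dominating series
when passing to the limit in the finite triple product. -/
lemma norm_invQfact_le {q : ℂ} (hq : ‖q‖ < 1) : ∃ C : ℝ, ∀ k, ‖invQfact q k‖ ≤ C := by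
  obtain ⟨L, hL, hlim⟩ := exists_tendsto_qfact hq
  obtain ⟨C, hC⟩ := (Metric.isBounded_range_of_tendsto _ (hlim.inv₀ hL)).exists_norm_le
  refine ⟨C, fun k => ?_⟩
  unfold invQfact
  split_ifs with h
  · exact hC _ ⟨k.toNat, rfl⟩
  · rw [norm_zero]; exact (norm_nonneg _).trans (hC _ ⟨0, rfl⟩)

lemma tendsto_invQfact {q : ℂ} {L : ℂ} (hL : L ≠ 0)
    (hlim : Tendsto (qfact q) atTop (𝓝 L)) {u : ℕ → ℤ} (hu : Tendsto u atTop atTop) :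
    Tendsto (fun n => invQfact q (u n)) atTop (𝓝 L⁻¹) := by
  have h1 : Tendsto (fun n => (u n).toNat) atTop atTop := by
    refine tendsto_atTop.mpr fun b => ?_
    filter_upwards [hu.eventually_ge_atTop (b : ℤ)] with n hn
    omega
  refine ((hlim.inv₀ hL).comp h1).congr' ?_
  filter_upwards [hu.eventually_ge_atTop 0] with n hn
  simp [invQfact, hn]

/-- The Jacobi triple product identity. -/
lemma tendsto_triple_product {q z : ℂ} (hq : ‖q‖ < 1) (hq0 : q ≠ 0) (hz : z ≠ 0) :
    Tendsto (fun n => qfact q n *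
      ∏ l ∈ Finset.range n, ((1 + z * q ^ (l + 1)) * (1 + q ^ l / z))) atTop
      (𝓝 (fullTheta q z)) := by
  obtain ⟨L, hL, hlim⟩ := exists_tendsto_qfact hq
  obtain ⟨C, hC⟩ := norm_invQfact_le hq
  obtain ⟨C', hC'⟩ := (Metric.isBounded_range_of_tendsto _ hlim).exists_norm_le
  have hC0 : 0 ≤ C := (norm_nonneg _).trans (hC 0)
  have hC0' : 0 ≤ C' := (norm_nonneg _).trans (hC' _ ⟨0, rfl⟩)
  have h2 : Tendsto (fun n : ℕ => 2 * n) atTop atTop :=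
    tendsto_id.const_mul_atTop' (by norm_num : 0 < 2)
  have hcast : Tendsto (fun n : ℕ => (n : ℤ)) atTop atTop := tendsto_natCast_atTop_atTop
  have key : Tendsto (fun n : ℕ => ∑' m : ℤ, qfact q (2 * n) * invQfact q (n + m)
      * invQfact q (n - m) * thetaTerm q z m) atTop
      (𝓝 (∑' m : ℤ, L * L⁻¹ * L⁻¹ * thetaTerm q z m)) := by
    refine tendsto_tsum_of_dominated_convergence
      ((summable_norm_thetaTerm hq z).mul_left (C' * C * C)) (fun m => ?_) (.of_forall fun n m => ?_)
    · refine (((hlim.comp h2).mul (tendsto_invQfact hL hlim ?_)).mul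
        (tendsto_invQfact hL hlim ?_)).mul_const _
      · exact tendsto_atTop_add_const_right _ _ hcast
      · exact tendsto_atTop_add_const_right _ (-m) hcast
    · rw [norm_mul, norm_mul, norm_mul]
      gcongr
      · exact hC' _ ⟨_, rfl⟩
      · exact hC _
      · exact hC _
  rw [tsum_mul_left, (hasSum_thetaTerm hq z).tsum_eq] at key
  -- The limit of the finite products is `L⁻¹` times the full theta function; the prefactor `qfact q
  -- n` tends to `L` and cancels it.
  have := hlim.mul key
  rw [mul_inv_cancel₀ hL, one_mul, ← mul_assoc, mul_inv_cancel₀ hL, one_mul] at this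
  refine this.congr fun n => ?_
  rw [(hasSum_finite_triple_product hq hq0 hz n).tsum_eq]

/-! ### A lower bound for the full theta function -/

/-- After the triangle inequality, `(1 - t R) (1 - R / t) = 1 + R ^ 2 - R (t + 1 / t)` with `t =
‖z‖`. On `[s, s⁻¹]` the sum `t + 1 / t` is largest at the endpoints, which give the stated factors.
-/
lemma norm_triple_factor_ge {q z : ℂ} {s : ℝ} (hs0 : 0 < s) (hs1 : s < 1) (hq : ‖q‖ = s ^ 2)
    (h1 : s ≤ ‖z‖) (h2 : ‖z‖ ≤ s⁻¹) (l : ℕ) :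
    (1 - s ^ (2 * l + 1)) * (1 - s ^ (2 * l + 2)) * (1 - s ^ (2 * l + 3))
      ≤ ‖(1 - q ^ (l + 1)) * (1 + z * q ^ (l + 1)) * (1 + q ^ (l + 1) / z)‖ := by
  set t := ‖z‖ with ht
  have ht0 : 0 < t := hs0.trans_le h1
  set R := s ^ (2 * l + 2) with hR
  have hRq : ‖q ^ (l + 1)‖ = R := by rw [norm_pow, hq, hR, ← pow_mul]; congr 1
  have hR0 : 0 < R := by positivity
  have e1 : s ^ (2 * l + 1) = R / s := by rw [hR]; field_simp; ring
  have e3 : s ^ (2 * l + 3) = R * s := by rw [hR]; ring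
  have hRs : R / s ≤ 1 := by rw [← e1]; exact pow_le_one₀ hs0.le hs1.le
  have hRs' : R * s ≤ 1 := by rw [← e3]; exact pow_le_one₀ hs0.le hs1.le
  have hR1 : R ≤ 1 := pow_le_one₀ hs0.le hs1.le
  have hts : t * s ≤ 1 := by
    calc t * s ≤ s⁻¹ * s := by gcongr
      _ = 1 := inv_mul_cancel₀ hs0.ne'
  have hRs2 : R ≤ s := by rwa [div_le_one hs0] at hRs
  have b1 : 1 - R ≤ ‖1 - q ^ (l + 1)‖ := by
    have := norm_sub_norm_le (1 : ℂ) (q ^ (l + 1))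
    rwa [norm_one, hRq] at this
  have b2 : 1 - t * R ≤ ‖1 + z * q ^ (l + 1)‖ := by
    have := norm_sub_norm_le (1 : ℂ) (-(z * q ^ (l + 1)))
    rwa [norm_one, norm_neg, norm_mul, hRq, sub_neg_eq_add] at this
  have b3 : 1 - R / t ≤ ‖1 + q ^ (l + 1) / z‖ := by
    have := norm_sub_norm_le (1 : ℂ) (-(q ^ (l + 1) / z))
    rwa [norm_one, norm_neg, norm_div, hRq, sub_neg_eq_add] at this
  have c2 : 0 ≤ 1 - t * R := by nlinarith
  have c3 : 0 ≤ 1 - R / t := by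
    rw [sub_nonneg, div_le_one ht0]; linarith
  rw [e1, e3, norm_mul, norm_mul]
  have main : (1 - R / s) * (1 - R * s) ≤ (1 - t * R) * (1 - R / t) := by
    have : (1 - t * R) * (1 - R / t) - (1 - R / s) * (1 - R * s)
        = R * ((t - s) * (1 - t * s)) / (t * s) := by field_simp; ring
    have : 0 ≤ R * ((t - s) * (1 - t * s)) / (t * s) := by
      have := sub_nonneg.mpr h1
      have := sub_nonneg.mpr hts
      positivity
    linarith
  calc (1 - R / s) * (1 - R) * (1 - R * s) = (1 - R) * ((1 - R / s) * (1 - R * s)) := by ring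
    _ ≤ (1 - R) * ((1 - t * R) * (1 - R / t)) := by
        have := sub_nonneg.mpr hR1
        gcongr
    _ = (1 - R) * (1 - t * R) * (1 - R / t) := by ring
    _ ≤ _ := by
        have := sub_nonneg.mpr hR1
        gcongr

/-- In this annulus the only vanishing factor of the triple product is `1 + z⁻¹`. It is split off,
and the remaining factors are bounded below uniformly. -/
lemma norm_fullTheta_ge {q z : ℂ} {s μ : ℝ} (hs0 : 0 < s) (hs1 : s < 1) (hq : ‖q‖ = s ^ 2)
    (h1 : s ≤ ‖z‖) (h2 : ‖z‖ ≤ s⁻¹)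
    (hμ : ∀ n, μ ≤ ∏ l ∈ Finset.range n,
      ((1 - s ^ (2 * l + 1)) * (1 - s ^ (2 * l + 2)) * (1 - s ^ (2 * l + 3)))) :
    μ * ‖1 + z⁻¹‖ ≤ ‖fullTheta q z‖ := by
  have hq1 : ‖q‖ < 1 := by rw [hq]; exact pow_lt_one₀ hs0.le hs1 two_ne_zero
  have hq0 : q ≠ 0 := norm_pos_iff.mp (by rw [hq]; positivity)
  have hz : z ≠ 0 := norm_pos_iff.mp (hs0.trans_le h1)
  -- An extra factor tending to `1` completes the index shift from `1 + q ^ l / z` to `1 + q ^ (l +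
  -- 1) / z` that isolates `1 + z⁻¹`.
  have hlast : Tendsto (fun n : ℕ => 1 + q ^ n / z) atTop (𝓝 (1 + 0 / z)) :=
    ((tendsto_pow_atTop_nhds_zero_of_norm_lt_one hq1).div_const z).const_add 1
  have h := ((tendsto_triple_product hq1 hq0 hz).mul hlast).norm
  rw [zero_div, add_zero, mul_one] at h
  refine ge_of_tendsto' h fun n => ?_
  have e : (qfact q n * ∏ l ∈ Finset.range n, ((1 + z * q ^ (l + 1)) * (1 + q ^ l / z)))
      * (1 + q ^ n / z)
      = (∏ l ∈ Finset.range n,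
        ((1 - q ^ (l + 1)) * (1 + z * q ^ (l + 1)) * (1 + q ^ (l + 1) / z))) * (1 + z⁻¹) := by
    have : (∏ l ∈ Finset.range n, (1 + q ^ l / z)) * (1 + q ^ n / z)
        = (∏ l ∈ Finset.range n, (1 + q ^ (l + 1) / z)) * (1 + z⁻¹) := by
      rw [← Finset.prod_range_succ (fun l => 1 + q ^ l / z),
        Finset.prod_range_succ' (fun l => 1 + q ^ l / z)]
      simp
    rw [qfact, Finset.prod_mul_distrib, Finset.prod_mul_distrib, Finset.prod_mul_distrib,
      ← mul_assoc, mul_assoc _ (∏ l ∈ Finset.range n, (1 + q ^ l / z)), this]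
    ring
  rw [e, norm_mul, norm_prod]
  gcongr
  refine (hμ n).trans (Finset.prod_le_prod (fun l _ => ?_) fun l _ =>
    norm_triple_factor_ge hs0 hs1 hq h1 h2 l)
  have := fun k : ℕ => sub_nonneg.mpr (pow_le_one₀ hs0.le hs1.le (n := k))
  exact mul_nonneg (mul_nonneg (this _) (this _)) (this _)

/-- Quasi-periodicity of the full theta function. -/
lemma fullTheta_div_pow {q w : ℂ} (hq : ‖q‖ < 1) (hq0 : q ≠ 0) (hw : w ≠ 0) (k : ℕ) :
    fullTheta q (w / q ^ (k + 1)) = w ^ (k + 1) / q ^ tri k * fullTheta q w := by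
  have step : ∀ z : ℂ, z ≠ 0 → fullTheta q (z / q) = z * fullTheta q z := by
    intro z hz
    have a := theta_functional hq (z / q)
    have b := theta_functional hq z⁻¹
    have e1 : q * (z / q) = z := by field_simp
    have e2 : (z / q)⁻¹ = q * z⁻¹ := by field_simp
    rw [e1] at a
    rw [fullTheta, fullTheta, e2, a, mul_add, ← mul_assoc z z⁻¹, mul_inv_cancel₀ hz, one_mul, b]
    ring
  induction k with
  | zero => simpa [tri_zero] using step w hw
  | succ k ih =>
    rw [pow_succ, ← div_div, step _ (by positivity), ih, tri_succ]
    field_simp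
    ring


/-! ### Zeros in an annulus -/

lemma norm_add_one_ge_of_norm_eq {w : ℂ} {s : ℝ} (hs0 : 0 < s) (hs1 : s < 1)
    (hw : ‖w‖ = s ∨ ‖w‖ = s⁻¹) : 1 - s ≤ ‖w + 1‖ := by
  have hsi : 1 - s ≤ s⁻¹ - 1 := by
    have : 0 ≤ (1 - s) ^ 2 / s := by positivity
    have e : s⁻¹ - 1 - (1 - s) = (1 - s) ^ 2 / s := by field_simp
    linarith
  rcases hw with h | h
  · have := norm_sub_norm_le (1 : ℂ) (-w)
    rw [norm_one, norm_neg, h, sub_neg_eq_add, add_comm] at this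
    exact this
  · have := norm_sub_norm_le w (-1 : ℂ)
    rw [norm_neg, norm_one, h, sub_neg_eq_add] at this
    linarith

/-- Let `Θ` have a zero at `-1` and satisfy a suitable lower bound in the annulus
`s ≤ |w| ≤ 1 / s`. Then a small perturbation `f` of `Θ` has at most one zero, counted with
multiplicity, in the annulus. -/
lemma dslope_ne_zero_of_close {f Θ : ℂ → ℂ} {u : ℂ → ℝ} {s μ ε η δ κ l : ℝ} (hs0 : 0 < s)
    (hs1 : s < 1) (hf : DifferentiableOn ℂ f {0}ᶜ) (hΘ : DifferentiableOn ℂ Θ {0}ᶜ)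
    (hΘ1 : Θ (-1) = 0) (hu : ContinuousAt u (-1)) (hμ : 0 < μ)
    (hu0 : ∀ w, s ≤ ‖w‖ → ‖w‖ ≤ s⁻¹ → 0 < u w)
    (hlow : ∀ w, s ≤ ‖w‖ → ‖w‖ ≤ s⁻¹ → μ * ‖1 + w⁻¹‖ * u w ≤ ‖Θ w‖)
    (hclose : ∀ w, s ≤ ‖w‖ → ‖w‖ ≤ s⁻¹ → ‖f w - Θ w‖ ≤ ε * u w)
    (hη : ε ≤ μ * η) (hη1 : η < 1) (hδ : η ≤ δ * (1 - η)) (hδ1 : δ < 1 - s)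
    (hκ : η ≤ κ * (1 - s)) (hl : δ ≤ l * (1 - s - δ)) (hc : κ + l + κ * l < 1)
    {w₀ w : ℂ} (hw₀ : s ≤ ‖w₀‖) (hw₀' : ‖w₀‖ ≤ s⁻¹) (h0 : f w₀ = 0)
    (hw : s ≤ ‖w‖) (hw' : ‖w‖ ≤ s⁻¹) : dslope f w₀ w ≠ 0 := by
  have hne : ∀ w : ℂ, s ≤ ‖w‖ → w ≠ 0 := fun w h => norm_pos_iff.mp (hs0.trans_le h)
  have hs2 : 1 < s⁻¹ := (one_lt_inv₀ hs0).mpr hs1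
  have hopen : IsOpen ({0}ᶜ : Set ℂ) := isOpen_compl_singleton
  have inv_form : ∀ w : ℂ, w ≠ 0 → ‖1 + w⁻¹‖ * ‖w‖ = ‖w + 1‖ := fun w h => by
    rw [← norm_mul, add_mul, inv_mul_cancel₀ h, one_mul]
  -- the zero of `f` is close to `-1`
  have hw₀1 : ‖1 + w₀‖ ≤ δ := by
    have a := hlow w₀ hw₀ hw₀'
    have b := hclose w₀ hw₀ hw₀'
    rw [h0, zero_sub, norm_neg] at b
    have hu := hu0 w₀ hw₀ hw₀'
    have c : ‖1 + w₀⁻¹‖ ≤ η := by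
      have : μ * ‖1 + w₀⁻¹‖ * u w₀ ≤ μ * η * u w₀ := a.trans (b.trans (by gcongr))
      exact le_of_mul_le_mul_left (le_of_mul_le_mul_right this hu) hμ
    have d := inv_form w₀ (hne _ hw₀)
    rw [add_comm w₀ 1] at d
    have e : ‖w₀‖ ≤ 1 + ‖1 + w₀‖ := by
      have := norm_sub_le (1 + w₀) 1
      rw [add_sub_cancel_left, norm_one] at this; linarith
    have hη0 : 0 ≤ η := (norm_nonneg _).trans c
    have g : ‖1 + w₀‖ ≤ η * (1 + ‖1 + w₀‖) := by
      rw [← d]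
      calc _ ≤ η * ‖w₀‖ := by gcongr
        _ ≤ _ := by rw [d]; gcongr
    have : ‖1 + w₀‖ * (1 - η) ≤ δ * (1 - η) := by linarith
    exact le_of_mul_le_mul_right this (by linarith)
  have hδ0 : 0 ≤ δ := (norm_nonneg _).trans hw₀1
  have hl0 : 0 ≤ l := by
    by_contra! h
    nlinarith
  have hlow' : ∀ w : ℂ, s ≤ ‖w‖ → ‖w‖ ≤ s⁻¹ → w ≠ -1 →
      μ * (u w / ‖w‖) ≤ ‖dslope Θ (-1) w‖ := by
    intro w h h' h1
    have hw1 : 0 < ‖w + 1‖ := norm_pos_iff.mpr (by rwa [← sub_neg_eq_add, sub_ne_zero])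
    have hwp : 0 < ‖w‖ := hs0.trans_le h
    rw [dslope_of_ne _ h1, slope_def_field, hΘ1, sub_zero, sub_neg_eq_add, norm_div,
      le_div_iff₀ hw1, ← inv_form w (hne w h)]
    calc _ = μ * ‖1 + w⁻¹‖ * u w := by field_simp
      _ ≤ _ := hlow w h h'
  have dΘ : DifferentiableOn ℂ (dslope Θ (-1)) {0}ᶜ :=
    (Complex.differentiableOn_dslope (hopen.mem_nhds (by simp))).mpr hΘ
  have df : DifferentiableOn ℂ (dslope f w₀) {0}ᶜ :=
    (Complex.differentiableOn_dslope (hopen.mem_nhds (hne _ hw₀))).mpr hf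
  have hne1 : ∀ w : ℂ, s ≤ ‖w‖ → ‖w‖ ≤ s⁻¹ → dslope Θ (-1) w ≠ 0 := by
    intro w h h'
    rcases eq_or_ne w (-1) with rfl | h1
    -- At `-1` itself the quotient form is unavailable, so the lower bound is carried over from
    -- punctured neighbourhoods by continuity. In particular the zero of `Θ` is simple.
    · have c1 : ContinuousAt (dslope Θ (-1)) (-1) :=
        (dΘ.differentiableAt (hopen.mem_nhds (by simp))).continuousAt
      have c2 : ContinuousAt (fun w => μ * (u w / ‖w‖)) (-1) :=
        continuousAt_const.mul (hu.div continuous_norm.continuousAt (by simp))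
      have ev : ∀ᶠ w in 𝓝[≠] (-1 : ℂ), μ * (u w / ‖w‖) ≤ ‖dslope Θ (-1) w‖ := by
        have o : IsOpen {w : ℂ | s < ‖w‖ ∧ ‖w‖ < s⁻¹} :=
          (isOpen_lt continuous_const continuous_norm).inter
            (isOpen_lt continuous_norm continuous_const)
        filter_upwards [self_mem_nhdsWithin, mem_nhdsWithin_of_mem_nhds
          (o.mem_nhds (show (-1 : ℂ) ∈ _ by simp [hs1, hs2]))] with w h1 h2
        exact hlow' w h2.1.le h2.2.le h1
      have := le_of_tendsto_of_tendsto (c2.tendsto.mono_left nhdsWithin_le_nhds)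
        (c1.norm.tendsto.mono_left nhdsWithin_le_nhds) ev
      have hp := hu0 (-1) h h'
      rw [← norm_pos_iff]
      refine lt_of_lt_of_le ?_ this
      simp only [norm_neg, norm_one, div_one]
      positivity
    · have hp := hu0 w h h'
      have hwp : 0 < ‖w‖ := hs0.trans_le h
      rw [← norm_pos_iff]
      exact lt_of_lt_of_le (by positivity) (hlow' w h h' h1)
  set h : ℂ → ℂ := fun w => dslope f w₀ w / dslope Θ (-1) w - 1 with hh
  -- On the boundary circles `h + 1` is the product of `f / Θ`, within `κ` of `1`, and `(w + 1) / (w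
  -- - w₀)`, within `l` of `1`. The bound is `(1 + κ) (1 + l) - 1`.
  have hbd : ∀ w : ℂ, ‖w‖ = s ∨ ‖w‖ = s⁻¹ → ‖h w‖ ≤ κ + l + κ * l := by
    intro w hwb
    have h1 : s ≤ ‖w‖ := by rcases hwb with h | h <;> rw [h]; linarith
    have h2 : ‖w‖ ≤ s⁻¹ := by rcases hwb with h | h <;> rw [h]; linarith
    have hw1 := norm_add_one_ge_of_norm_eq hs0 hs1 hwb
    have hwinv : 1 - s ≤ ‖1 + w⁻¹‖ := by
      have : ‖w⁻¹‖ = s ∨ ‖w⁻¹‖ = s⁻¹ := by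
        rw [norm_inv]
        rcases hwb with h | h
        · right; rw [h]
        · left; rw [h, inv_inv]
      rw [add_comm]; exact norm_add_one_ge_of_norm_eq hs0 hs1 this
    have hp := hu0 w h1 h2
    have hwne : w ≠ 0 := hne w h1
    have hw1p : w + 1 ≠ 0 := norm_pos_iff.mp (by linarith)
    have hwm1 : w ≠ -1 := fun h => hw1p (by rw [h]; ring)
    have hdist : 1 - s - δ ≤ ‖w - w₀‖ := by
      have := norm_sub_norm_le (w + 1) (1 + w₀)
      rw [show w + 1 - (1 + w₀) = w - w₀ by ring] at this
      linarith
    have hww : w - w₀ ≠ 0 := norm_pos_iff.mp (by linarith)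
    have hΘlow : μ * (1 - s) * u w ≤ ‖Θ w‖ := le_trans (by gcongr) (hlow w h1 h2)
    have hΘp : 0 < ‖Θ w‖ := lt_of_lt_of_le (by
      have : 0 < 1 - s := by linarith
      positivity) hΘlow
    have hΘne : Θ w ≠ 0 := norm_pos_iff.mp hΘp
    have hκ0 : 0 ≤ κ := by
      by_contra! hneg
      have : 0 ≤ ε * u w := (norm_nonneg _).trans (hclose w h1 h2)
      have : 0 ≤ ε := nonneg_of_mul_nonneg_left this hp
      have : 0 ≤ η := by
        by_contra! h
        nlinarith
      nlinarith
    have e1 : ‖(f w - Θ w) / Θ w‖ ≤ κ := by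
      rw [norm_div, div_le_iff₀ hΘp]
      calc _ ≤ ε * u w := hclose w h1 h2
        _ ≤ μ * (κ * (1 - s)) * u w := by
          have : ε ≤ μ * (κ * (1 - s)) := hη.trans (by gcongr)
          gcongr
        _ = κ * (μ * (1 - s) * u w) := by ring
        _ ≤ _ := by gcongr
    have e2 : ‖(1 + w₀) / (w - w₀)‖ ≤ l := by
      rw [norm_div, div_le_iff₀ (by linarith)]
      calc _ ≤ δ := hw₀1
        _ ≤ l * (1 - s - δ) := hl
        _ ≤ _ := by gcongr
    have e : h w = (f w - Θ w) / Θ w + (1 + w₀) / (w - w₀)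
        + (f w - Θ w) / Θ w * ((1 + w₀) / (w - w₀)) := by
      rw [hh]
      simp only
      rw [dslope_of_ne _ (sub_ne_zero.mp hww), dslope_of_ne _ hwm1, slope_def_field,
        slope_def_field, h0, hΘ1, sub_zero, sub_zero, sub_neg_eq_add]
      field_simp
      ring
    rw [e]
    refine (norm_add_le_of_le (norm_add_le_of_le e1 e2) ?_)
    rw [norm_mul]
    gcongr
  -- The maximum principle on the annulus extends the boundary bound inwards. A zero of `dslope f
  -- w₀` would give `h = -1`, which is too large.
  have hall : ‖h w‖ ≤ κ + l + κ * l := by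
    set U : Set ℂ := {w : ℂ | s < ‖w‖ ∧ ‖w‖ < s⁻¹} with hU
    have oU : IsOpen U := (isOpen_lt continuous_const continuous_norm).inter
      (isOpen_lt continuous_norm continuous_const)
    have cU : closure U ⊆ {w : ℂ | s ≤ ‖w‖ ∧ ‖w‖ ≤ s⁻¹} :=
      closure_minimal (fun w hw => ⟨hw.1.le, hw.2.le⟩)
        ((isClosed_le continuous_const continuous_norm).inter
          (isClosed_le continuous_norm continuous_const))
    have bU : Bornology.IsBounded U :=
      Metric.isBounded_closedBall (x := (0 : ℂ)) (r := s⁻¹) |>.subset fun w hw => by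
        simpa using hw.2.le
    by_cases hwU : w ∈ U
    · refine Complex.norm_le_of_forall_mem_frontier_norm_le bU ?_ (fun z hz => ?_)
        (subset_closure hwU)
      · refine DifferentiableOn.diffContOnCl (DifferentiableOn.sub_const (DifferentiableOn.div
          (df.mono fun z hz => hne z (cU hz).1) (dΘ.mono fun z hz => hne z (cU hz).1)
          fun z hz => hne1 z (cU hz).1 (cU hz).2) 1)
      · rw [oU.frontier_eq] at hz
        have hz1 := cU hz.1
        refine hbd z ?_
        by_contra! hcon
        exact hz.2 ⟨lt_of_le_of_ne hz1.1 hcon.1.symm, lt_of_le_of_ne hz1.2 hcon.2⟩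
    · refine hbd w ?_
      by_contra! hcon
      exact hwU ⟨lt_of_le_of_ne hw hcon.1.symm, lt_of_le_of_ne hw' hcon.2⟩
  intro hz
  rw [hh] at hall
  simp only [hz, zero_div, zero_sub, norm_neg, norm_one] at hall
  linarith

/-! ### Multiplicities from factorizations, and the zeros of large modulus. -/

lemma analyticAt_theta {q : ℂ} (hq : ‖q‖ < 1) (z : ℂ) : AnalyticAt ℂ (theta q) z :=
  (differentiable_theta hq).analyticAt z

lemma isZeroOfOrder_of_eq {q z₀ : ℂ} (hq : ‖q‖ < 1) {m : ℕ} (hm : m ≠ 0) {g : ℂ → ℂ}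
    (hg : AnalyticAt ℂ g z₀) (hg0 : g z₀ ≠ 0)
    (h : ∀ z, theta q z = (z - z₀) ^ m * g z) : IsZeroOfOrder q z₀ m :=
  ⟨by rw [h, sub_self, zero_pow hm, zero_mul], (analyticAt_theta hq z₀).analyticOrderAt_eq_natCast.mpr
    ⟨g, hg, hg0, .of_forall h⟩⟩

lemma differentiable_dslope {f : ℂ → ℂ} (hf : Differentiable ℂ f) (a : ℂ) :
    Differentiable ℂ (dslope f a) := by
  rw [← differentiableOn_univ] at hf ⊢
  exact (Complex.differentiableOn_dslope Filter.univ_mem).mpr hf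

lemma eq_mul_dslope {f : ℂ → ℂ} {a : ℂ} (h : f a = 0) (z : ℂ) : f z = (z - a) * dslope f a z := by
  have := sub_smul_dslope f a z
  rw [h, sub_zero, smul_eq_mul] at this
  exact this.symm

lemma isZeroOfOrder_one_of_deriv {q z₀ : ℂ} (hq : ‖q‖ < 1) (h : theta q z₀ = 0)
    (hd : deriv (theta q) z₀ ≠ 0) : IsZeroOfOrder q z₀ 1 := by
  refine isZeroOfOrder_of_eq hq one_ne_zero
    ((differentiable_dslope (differentiable_theta hq) z₀).analyticAt z₀) (by rwa [dslope_same])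
    fun z => ?_
  rw [pow_one]
  exact eq_mul_dslope h z

/-- The distance between `θ` and the full theta function in an annulus. -/
lemma norm_theta_sub_fullTheta_le {q w : ℂ} {s : ℝ} (hs0 : 0 < s) (hs1 : s < 1)
    (hq : ‖q‖ = s ^ 2) (hs : s ≤ ‖w‖) (k : ℕ) (hk : s ^ (2 * k + 5) ≤ 1 / 2) :
    ‖theta q (w / q ^ (k + 1)) - fullTheta q (w / q ^ (k + 1))‖
      ≤ s ^ ((k + 1) ^ 2 - 1) * (1 + 2 * s ^ (2 * k + 3)) * ‖w ^ (k + 1) / q ^ tri k‖ := by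
  have hq1 : ‖q‖ < 1 := by rw [hq]; exact pow_lt_one₀ hs0.le hs1 two_ne_zero
  have hw0 : 0 < ‖w‖ := hs0.trans_le hs
  set z := w / q ^ (k + 1) with hz
  have hzi : ‖z⁻¹‖ = s ^ (2 * k + 2) / ‖w‖ := by
    rw [hz, inv_div, norm_div, norm_pow, hq, ← pow_mul]; congr 2
  have hzi' : ‖z⁻¹‖ ≤ s ^ (2 * k + 1) := by
    rw [hzi, div_le_iff₀ hw0, pow_succ s (2 * k + 1)]
    gcongr
  have hth : ‖theta q z⁻¹‖ ≤ 1 + 2 * s ^ (2 * k + 3) := by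
    refine (norm_theta_le hq1 hzi').trans ((majorant_le (norm_nonneg q) hq1 (by positivity) 1
      ?_).trans (le_of_eq ?_))
    · rw [hq]
      refine le_trans (le_of_eq ?_) hk
      ring
    · have : tri 1 = 1 := rfl
      rw [hq, Finset.sum_range_one, this, tri_zero]
      ring
  have e : theta q z - fullTheta q z = -(z⁻¹ * theta q z⁻¹) := by rw [fullTheta]; ring
  rw [e, norm_neg, norm_mul, hzi]
  have hexp : (k + 1) ^ 2 - 1 = k ^ 2 + 2 * k := by
    rw [show (k + 1) ^ 2 = k ^ 2 + 2 * k + 1 by ring, Nat.add_sub_cancel]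
  have htri : 2 * tri k = k ^ 2 + k := by
    unfold tri
    rw [Nat.mul_div_cancel' (Nat.even_mul_succ_self k).two_dvd]; ring
  rw [hexp, norm_div, norm_pow, norm_pow, hq, ← pow_mul, htri]
  calc s ^ (2 * k + 2) / ‖w‖ * ‖theta q z⁻¹‖
      ≤ s ^ (2 * k + 2) / ‖w‖ * (1 + 2 * s ^ (2 * k + 3)) := by gcongr
    _ = (s ^ (2 * k + 2) / ‖w‖ * 1) * (1 + 2 * s ^ (2 * k + 3)) := by ring
    _ ≤ (s ^ (k ^ 2 + 2 * k) * (‖w‖ ^ (k + 1) / s ^ (k ^ 2 + k))) * (1 + 2 * s ^ (2 * k + 3)) := by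
        refine mul_le_mul_of_nonneg_right ?_ (by positivity)
        rw [mul_one, mul_div_assoc', div_le_div_iff₀ hw0 (by positivity)]
        calc s ^ (2 * k + 2) * s ^ (k ^ 2 + k) = s ^ (k ^ 2 + 2 * k) * s ^ (k + 2) := by ring
          _ ≤ s ^ (k ^ 2 + 2 * k) * ‖w‖ ^ (k + 2) := by gcongr
          _ = s ^ (k ^ 2 + 2 * k) * ‖w‖ ^ (k + 1) * ‖w‖ := by ring
    _ = _ := by ring

lemma deriv_comp_div_const (f : ℂ → ℂ) (c x : ℂ) :
    deriv (fun w => f (w / c)) x = deriv f (x / c) / c := by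
  simpa only [div_eq_inv_mul, smul_eq_mul] using deriv_comp_mul_left c⁻¹ f x

/-- For `|q| = s ^ 2` and under suitable numerical conditions, the zeros of `θ(q, ·)` of modulus at
least `s ^ (-(2 k₀ + 1))` are simple and have pairwise distinct moduli. -/
lemma zeros_outside {q : ℂ} {s μ η δ κ l : ℝ} {k₀ : ℕ} (hs0 : 0 < s) (hs1 : s < 1)
    (hq : ‖q‖ = s ^ 2) (hμ0 : 0 < μ)
    (hμ : ∀ n, μ ≤ ∏ l ∈ Finset.range n,
      ((1 - s ^ (2 * l + 1)) * (1 - s ^ (2 * l + 2)) * (1 - s ^ (2 * l + 3))))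
    (hk : s ^ (2 * k₀ + 5) ≤ 1 / 2)
    (hη : s ^ ((k₀ + 1) ^ 2 - 1) * (1 + 2 * s ^ (2 * k₀ + 3)) ≤ μ * η) (hη1 : η < 1)
    (hδ : η ≤ δ * (1 - η)) (hδ1 : δ < 1 - s)
    (hκ : η ≤ κ * (1 - s)) (hl : δ ≤ l * (1 - s - δ)) (hc : κ + l + κ * l < 1) {z₀ : ℂ}
    (hz : 1 ≤ ‖z₀‖ * s ^ (2 * k₀ + 1)) (h0 : theta q z₀ = 0) :
    IsZeroOfOrder q z₀ 1 ∧ ∀ z, theta q z = 0 → ‖z‖ = ‖z₀‖ → z = z₀ := by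
  have hq1 : ‖q‖ < 1 := by rw [hq]; exact pow_lt_one₀ hs0.le hs1 two_ne_zero
  have hq0 : q ≠ 0 := norm_pos_iff.mp (by rw [hq]; positivity)
  -- With `k = k₀ + n` this places `z₀` in `s ^ (-(2 k + 1)) ≤ ‖z‖ ≤ s ^ (-(2 k + 3))`, which `w = z
  -- * q ^ (k + 1)` maps to `s ≤ ‖w‖ ≤ s⁻¹`.
  obtain ⟨n, hn1, hn2⟩ := exists_nat_pow_near hz
    ((one_lt_inv₀ (pow_pos hs0 2)).mpr (pow_lt_one₀ hs0.le hs1 two_ne_zero))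
  obtain ⟨k, hkn⟩ : ∃ k, k = k₀ + n := ⟨_, rfl⟩
  have hQ : ‖q ^ (k + 1)‖ = s ^ (2 * k + 2) := by rw [norm_pow, hq, ← pow_mul]; congr 1
  have hQ0 : q ^ (k + 1) ≠ 0 := pow_ne_zero _ hq0
  have ann : ∀ z : ℂ, ‖z‖ = ‖z₀‖ → s ≤ ‖z * q ^ (k + 1)‖ ∧ ‖z * q ^ (k + 1)‖ ≤ s⁻¹ := by
    intro z hzz
    rw [norm_mul, hQ, hzz]
    rw [inv_pow, ← pow_mul, inv_le_iff_one_le_mul₀ (by positivity)] at hn1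
    rw [inv_pow, ← pow_mul, lt_inv_comm₀ (by positivity) (by positivity), ] at hn2
    have hn3 : ‖z₀‖ * s ^ (2 * k₀ + 1) * s ^ (2 * (n + 1)) ≤ 1 := by
      have hp : 0 < ‖z₀‖ * s ^ (2 * k₀ + 1) := by linarith
      calc _ ≤ ‖z₀‖ * s ^ (2 * k₀ + 1) * (‖z₀‖ * s ^ (2 * k₀ + 1))⁻¹ := by gcongr
        _ = 1 := mul_inv_cancel₀ hp.ne'
    constructor
    · calc s = s * 1 := (mul_one s).symm
        _ ≤ s * (‖z₀‖ * s ^ (2 * k₀ + 1) * s ^ (2 * n)) := by gcongr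
        _ = _ := by rw [hkn]; ring
    · rw [← one_div, le_div_iff₀ hs0]
      refine le_trans (le_of_eq ?_) hn3
      rw [hkn]; ring
  have scale : Differentiable ℂ fun w : ℂ => w / q ^ (k + 1) := by fun_prop
  have main : ∀ w : ℂ, s ≤ ‖w‖ → ‖w‖ ≤ s⁻¹ →
      dslope (fun w => theta q (w / q ^ (k + 1))) (z₀ * q ^ (k + 1)) w ≠ 0 :=
    -- The function `u` is the modulus of the quasi-periodicity factor. It scales both the lower
    -- bound and the error, and the remaining relative error decreases with `k`, so the numerical
    -- conditions are needed only at `k₀`.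
    fun w hw hw' => dslope_ne_zero_of_close (f := fun w => theta q (w / q ^ (k + 1)))
    (Θ := fun w => fullTheta q (w / q ^ (k + 1))) (u := fun w => ‖w ^ (k + 1) / q ^ tri k‖)
    (s := s) (μ := μ) (ε := s ^ ((k + 1) ^ 2 - 1) * (1 + 2 * s ^ (2 * k + 3)))
    (η := η) (δ := δ) (κ := κ) (l := l) (w₀ := z₀ * q ^ (k + 1)) (w := w) hs0 hs1
    ((differentiable_theta hq1).comp scale).differentiableOn
    (by
      unfold fullTheta
      have hi : DifferentiableOn ℂ (fun w : ℂ => (w / q ^ (k + 1))⁻¹) {0}ᶜ :=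
        scale.differentiableOn.inv fun w hw => div_ne_zero hw hQ0
      exact ((differentiable_theta hq1).comp scale).differentiableOn.add
        (hi.mul ((differentiable_theta hq1).comp_differentiableOn hi)))
    (by
      have h1 : fullTheta q (-1) = 0 := by
        rw [fullTheta, inv_neg, inv_one]; ring
      rw [fullTheta_div_pow hq1 hq0 (by norm_num), h1, mul_zero])
    (by fun_prop) hμ0
    (fun w hw _ => by
      have : w ≠ 0 := norm_pos_iff.mp (hs0.trans_le hw)
      rw [norm_pos_iff]; positivity)
    (fun w hw hw' => by
      have : w ≠ 0 := norm_pos_iff.mp (hs0.trans_le hw)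
      rw [fullTheta_div_pow hq1 hq0 this, norm_mul, mul_comm]
      gcongr
      exact norm_fullTheta_ge hs0 hs1 hq hw hw' hμ)
    (fun w hw hw' => norm_theta_sub_fullTheta_le hs0 hs1 hq hw k (le_trans
      (pow_le_pow_of_le_one hs0.le hs1.le (by omega)) hk))
    (by
      refine le_trans ?_ hη
      have hkk : k₀ ≤ k := by omega
      have a1 : s ^ ((k + 1) ^ 2 - 1) ≤ s ^ ((k₀ + 1) ^ 2 - 1) :=
        pow_le_pow_of_le_one hs0.le hs1.le (Nat.sub_le_sub_right (by gcongr) 1)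
      have a2 : s ^ (2 * k + 3) ≤ s ^ (2 * k₀ + 3) :=
        pow_le_pow_of_le_one hs0.le hs1.le (by omega)
      gcongr) hη1 hδ hδ1 hκ hl hc (ann z₀ rfl).1 (ann z₀ rfl).2
    (by simp only [mul_div_cancel_right₀ _ hQ0, h0]) hw hw'
  constructor
  -- A nonvanishing divided difference excludes both possibilities: on the diagonal it is the
  -- derivative, so the zero is simple, and off the diagonal it excludes a second zero of the same
  -- modulus.
  · refine isZeroOfOrder_one_of_deriv hq1 h0 fun hd => ?_
    refine main (z₀ * q ^ (k + 1)) (ann z₀ rfl).1 (ann z₀ rfl).2 ?_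
    rw [dslope_same]
    have h3 := deriv_comp_div_const (theta q) (q ^ (k + 1)) (z₀ * q ^ (k + 1))
    rw [mul_div_cancel_right₀ _ hQ0, hd, zero_div] at h3
    exact h3
  · intro z hzz hnorm
    by_contra hzne
    refine main (z * q ^ (k + 1)) (ann z hnorm).1 (ann z hnorm).2 ?_
    have hne : z * q ^ (k + 1) ≠ z₀ * q ^ (k + 1) := fun h => hzne (mul_right_cancel₀ hQ0 h)
    rw [dslope_of_ne _ hne, slope_def_field]
    simp only [mul_div_cancel_right₀ _ hQ0, hzz, h0, sub_zero, zero_div]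


/-! ### Numerical bounds for the products in the lower bound of the full theta function -/

/-- The factors in the lower bound for the full theta function. -/
noncomputable def tripleFactor (s : ℝ) (l : ℕ) : ℝ :=
  (1 - s ^ (2 * l + 1)) * (1 - s ^ (2 * l + 2)) * (1 - s ^ (2 * l + 3))

lemma tripleFactor_nonneg {s : ℝ} (h0 : 0 ≤ s) (h1 : s ≤ 1) (l : ℕ) : 0 ≤ tripleFactor s l := by
  have := fun k : ℕ => sub_nonneg.mpr (pow_le_one₀ h0 h1 (n := k))
  exact mul_nonneg (mul_nonneg (this _) (this _)) (this _)

lemma tripleFactor_le_one {s : ℝ} (h0 : 0 ≤ s) (h1 : s ≤ 1) (l : ℕ) : tripleFactor s l ≤ 1 := by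
  have a := fun k : ℕ => sub_nonneg.mpr (pow_le_one₀ h0 h1 (n := k))
  have b := fun k : ℕ => sub_le_self (1 : ℝ) (pow_nonneg h0 k)
  exact mul_le_one₀ (mul_le_one₀ (b _) (a _) (b _)) (a _) (b _)

lemma tripleFactor_anti {s t : ℝ} (h0 : 0 ≤ s) (hst : s ≤ t) (h1 : t ≤ 1) (l : ℕ) :
    tripleFactor t l ≤ tripleFactor s l := by
  have a := fun k : ℕ => sub_nonneg.mpr (pow_le_one₀ (h0.trans hst) h1 (n := k))
  have b := fun k : ℕ => sub_nonneg.mpr (pow_le_one₀ h0 (hst.trans h1) (n := k))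
  have c := fun k : ℕ => sub_le_sub_left (pow_le_pow_left₀ h0 hst k) 1
  exact mul_le_mul (mul_le_mul (c _) (c _) (a _) (b _)) (c _) (a _) (mul_nonneg (b _) (b _))

lemma one_sub_le_tripleFactor {s : ℝ} (h0 : 0 ≤ s) (h1 : s ≤ 1) (l : ℕ) :
    1 - 3 * s ^ (2 * l + 1) ≤ tripleFactor s l := by
  have a : s ^ (2 * l + 2) ≤ s ^ (2 * l + 1) := pow_le_pow_of_le_one h0 h1 (by omega)
  have b : s ^ (2 * l + 3) ≤ s ^ (2 * l + 1) := pow_le_pow_of_le_one h0 h1 (by omega)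
  have c := pow_nonneg h0 (2 * l + 1)
  have d := pow_nonneg h0 (2 * l + 2)
  have e := pow_nonneg h0 (2 * l + 3)
  have f : s ^ (2 * l + 1) ≤ 1 := pow_le_one₀ h0 h1
  have g : s ^ (2 * l + 3) ≤ 1 := pow_le_one₀ h0 h1
  unfold tripleFactor
  have : 1 - s ^ (2 * l + 1) - s ^ (2 * l + 2)
      ≤ (1 - s ^ (2 * l + 1)) * (1 - s ^ (2 * l + 2)) := by nlinarith
  nlinarith [mul_le_mul_of_nonneg_right this (sub_nonneg.mpr g)]

lemma prod_tripleFactor_tail_ge {s : ℝ} (h0 : 0 ≤ s) (h1 : s < 1) (J n : ℕ) :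
    1 - 3 * s ^ (2 * J + 1) / (1 - s ^ 2) ≤ ∏ l ∈ Finset.range n, tripleFactor s (J + l) := by
  have hp : 0 < 1 - s ^ 2 := sub_pos.mpr (pow_lt_one₀ h0 h1 two_ne_zero)
  -- Strengthened for the induction: the full geometric series is replaced by its partial sum, which
  -- is what the first `n` factors cost.
  have claim : ∀ n, 1 - 3 * s ^ (2 * J + 1) / (1 - s ^ 2) * (1 - s ^ (2 * n))
      ≤ ∏ l ∈ Finset.range n, tripleFactor s (J + l) := by
    intro n
    induction n with
    | zero => simp
    | succ n ih =>
      rw [Finset.prod_range_succ]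
      set P := ∏ l ∈ Finset.range n, tripleFactor s (J + l) with hP
      have hP0 : 0 ≤ P := Finset.prod_nonneg fun l _ => tripleFactor_nonneg h0 h1.le _
      have hP1 : P ≤ 1 := Finset.prod_le_one (fun l _ => tripleFactor_nonneg h0 h1.le _)
        fun l _ => tripleFactor_le_one h0 h1.le _
      have hf := one_sub_le_tripleFactor h0 h1.le (J + n)
      have hc := pow_nonneg h0 (2 * (J + n) + 1)
      have e : 3 * s ^ (2 * J + 1) / (1 - s ^ 2) * (1 - s ^ (2 * (n + 1)))
          = 3 * s ^ (2 * J + 1) / (1 - s ^ 2) * (1 - s ^ (2 * n)) + 3 * s ^ (2 * (J + n) + 1) := by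
        field_simp; ring
      rw [e]
      nlinarith [mul_le_mul_of_nonneg_left hf hP0]
  refine le_trans ?_ (claim n)
  have : 0 ≤ 3 * s ^ (2 * J + 1) / (1 - s ^ 2) := by positivity
  nlinarith [pow_nonneg h0 (2 * n)]

/-- The factors decrease in `s` and are at most `1`, so one may pass to the rational bound `t` and
append further factors. The first `J` are then computed and the rest estimated by a geometric
series. -/
lemma prod_tripleFactor_ge {s t : ℝ} (h0 : 0 ≤ s) (hst : s ≤ t) (h1 : t < 1) (J n : ℕ) :
    (∏ l ∈ Finset.range J, tripleFactor t l) * (1 - 3 * t ^ (2 * J + 1) / (1 - t ^ 2))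
      ≤ ∏ l ∈ Finset.range n, tripleFactor s l := by
  have ht := h0.trans hst
  calc _ ≤ (∏ l ∈ Finset.range J, tripleFactor t l)
        * ∏ l ∈ Finset.range n, tripleFactor t (J + l) := by
        gcongr
        · exact Finset.prod_nonneg fun l _ => tripleFactor_nonneg ht h1.le _
        · exact prod_tripleFactor_tail_ge ht h1 J n
    _ = ∏ l ∈ Finset.range (n + J), tripleFactor t l := by
        rw [add_comm, Finset.prod_range_add]
    _ ≤ ∏ l ∈ Finset.range n, tripleFactor t l := by
        rw [Finset.prod_range_add]
        exact mul_le_of_le_one_right (Finset.prod_nonneg fun l _ => tripleFactor_nonneg ht h1.le _)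
          (Finset.prod_le_one (fun l _ => tripleFactor_nonneg ht h1.le _)
            fun l _ => tripleFactor_le_one ht h1.le _)
    _ ≤ _ := Finset.prod_le_prod (fun l _ => tripleFactor_nonneg ht h1.le _)
        fun l _ => tripleFactor_anti h0 hst h1.le l

lemma prod_tripleFactor_ge_of_le_real {s : ℝ} (h0 : 0 ≤ s) (hs : s ≤ 5562 / 10000) (n : ℕ) :
    155 / 1000 ≤ ∏ l ∈ Finset.range n,
      ((1 - s ^ (2 * l + 1)) * (1 - s ^ (2 * l + 2)) * (1 - s ^ (2 * l + 3))) := by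
  refine le_trans ?_ (prod_tripleFactor_ge h0 hs (by norm_num) 6 n)
  norm_num [Finset.prod_range_succ, tripleFactor]

lemma prod_tripleFactor_ge_of_le_complex {s : ℝ} (h0 : 0 ≤ s) (hs : s ≤ 6726 / 10000) (n : ℕ) :
    338 / 10000 ≤ ∏ l ∈ Finset.range n,
      ((1 - s ^ (2 * l + 1)) * (1 - s ^ (2 * l + 2)) * (1 - s ^ (2 * l + 3))) := by
  refine le_trans ?_ (prod_tripleFactor_ge h0 hs (by norm_num) 6 n)
  norm_num [Finset.prod_range_succ, tripleFactor]

/-- Large zeros of `θ(q, ·)` for `|q| ≤ 0.3093`. -/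
lemma zeros_outside_of_norm_le_real {q : ℂ} {s : ℝ} (hs0 : 0 < s) (hs : s ≤ 5562 / 10000)
    (hq : ‖q‖ = s ^ 2) {z₀ : ℂ} (hz : 1 ≤ ‖z₀‖ * s ^ 5) (h0 : theta q z₀ = 0) :
    IsZeroOfOrder q z₀ 1 ∧ ∀ z, theta q z = 0 → ‖z‖ = ‖z₀‖ → z = z₀ := by
  have hpow : ∀ n, s ^ n ≤ (5562 / 10000) ^ n := fun n => pow_le_pow_left₀ hs0.le hs n
  -- Each constant is obtained from the previous one by rounding up the inequality that it must
  -- satisfy; the final quantity `κ + l + κ * l` is about `0.34`. In the complex case it is about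
  -- `0.74`.
  refine zeros_outside (μ := 155 / 1000) (η := 62 / 1000) (δ := 67 / 1000) (κ := 14 / 100)
    (l := 178 / 1000) (k₀ := 2) hs0 (by linarith) hq (by norm_num)
    (prod_tripleFactor_ge_of_le_real hs0.le hs) ((hpow _).trans (by norm_num)) ?_ (by norm_num)
    (by norm_num) (by linarith) (by linarith) (by linarith) (by norm_num) hz h0
  calc s ^ ((2 + 1) ^ 2 - 1) * (1 + 2 * s ^ (2 * 2 + 3))
      ≤ (5562 / 10000) ^ ((2 + 1) ^ 2 - 1) * (1 + 2 * (5562 / 10000) ^ (2 * 2 + 3)) := by gcongr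
    _ ≤ _ := by norm_num

/-- Large zeros of `θ(q, ·)` for `|q| ≤ 0.4523`. -/
lemma zeros_outside_of_norm_le_complex {q : ℂ} {s : ℝ} (hs0 : 0 < s) (hs : s ≤ 6726 / 10000)
    (hq : ‖q‖ = s ^ 2) {z₀ : ℂ} (hz : 1 ≤ ‖z₀‖ * s ^ 7) (h0 : theta q z₀ = 0) :
    IsZeroOfOrder q z₀ 1 ∧ ∀ z, theta q z = 0 → ‖z‖ = ‖z₀‖ → z = z₀ := by
  have hpow : ∀ n, s ^ n ≤ (6726 / 10000) ^ n := fun n => pow_le_pow_left₀ hs0.le hs n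
  refine zeros_outside (μ := 338 / 10000) (η := 83 / 1000) (δ := 906 / 10000) (κ := 254 / 1000)
    (l := 383 / 1000) (k₀ := 3) hs0 (by linarith) hq (by norm_num)
    (prod_tripleFactor_ge_of_le_complex hs0.le hs) ((hpow _).trans (by norm_num)) ?_ (by norm_num)
    (by norm_num) (by linarith) (by linarith) (by linarith) (by norm_num) hz h0
  calc s ^ ((3 + 1) ^ 2 - 1) * (1 + 2 * s ^ (2 * 3 + 3))
      ≤ (6726 / 10000) ^ ((3 + 1) ^ 2 - 1) * (1 + 2 * (6726 / 10000) ^ (2 * 3 + 3)) := by gcongr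
    _ ≤ _ := by norm_num


/-! ### Zeros in a disc -/

/-- If `P * g` is close to `P * B` on a circle and `B` has no zeros in the disc, then `g` has no
zeros in the disc. -/
lemma ne_zero_of_close_on_circle {P B g : ℂ → ℂ} {R c : ℝ} (hR : 0 < R)
    (hg : Differentiable ℂ g) (hB : Differentiable ℂ B) (hB0 : ∀ z, ‖z‖ ≤ R → B z ≠ 0)
    (hP : ∀ z, ‖z‖ = R → P z ≠ 0) (hc : c < 1)
    (hclose : ∀ z, ‖z‖ = R → ‖P z * g z - P z * B z‖ ≤ c * ‖P z * B z‖) {z : ℂ} (hz : ‖z‖ ≤ R) :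
    g z ≠ 0 := by
  intro h
  have hcl : closure (Metric.ball (0 : ℂ) R) = Metric.closedBall 0 R := closure_ball 0 hR.ne'
  have key : ‖g z / B z - 1‖ ≤ c := by
    refine Complex.norm_le_of_forall_mem_frontier_norm_le (U := Metric.ball (0 : ℂ) R)
      (f := fun z => g z / B z - 1) Metric.isBounded_ball ?_ (fun w hw => ?_) (by
        rw [hcl, mem_closedBall_zero_iff]; exact hz)
    · refine DifferentiableOn.diffContOnCl (DifferentiableOn.sub_const (DifferentiableOn.div
        hg.differentiableOn hB.differentiableOn fun w hw => hB0 w ?_) 1)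
      rwa [hcl, mem_closedBall_zero_iff] at hw
    · rw [frontier_ball 0 hR.ne', mem_sphere_zero_iff_norm] at hw
      have h1 := hP w hw
      have h2 := hB0 w hw.le
      have e : g w / B w - 1 = (P w * g w - P w * B w) / (P w * B w) := by field_simp
      rw [e, norm_div, div_le_iff₀ (norm_pos_iff.mpr (mul_ne_zero h1 h2))]
      exact hclose w hw
  rw [h, zero_div, zero_sub, norm_neg, norm_one] at key
  linarith

/-- The coefficients of `∏ (1 - γ X)`. -/
def prodCoeff : List GaussianInt → ℕ → GaussianInt
  | [], 0 => 1
  | [], _ + 1 => 0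
  | _ :: L, 0 => prodCoeff L 0
  | γ :: L, j + 1 => prodCoeff L (j + 1) - γ * prodCoeff L j

lemma prod_eq_sum_prodCoeff (L : List GaussianInt) (y : ℂ) {N : ℕ} (hN : L.length < N) :
    (L.map fun γ => 1 - GaussianInt.toComplex γ * y).prod
      = ∑ j ∈ Finset.range N, GaussianInt.toComplex (prodCoeff L j) * y ^ j := by
  induction L generalizing N with
  | nil =>
    obtain ⟨n, rfl⟩ : ∃ n, N = n + 1 := ⟨N - 1, by simp at hN; omega⟩
    rw [Finset.sum_range_succ']
    simp [prodCoeff]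
  | cons γ L ih =>
    rw [List.length_cons] at hN
    obtain ⟨n, rfl⟩ : ∃ n, N = n + 1 := ⟨N - 1, by omega⟩
    rw [List.map_cons, List.prod_cons, sub_mul, one_mul, ih (N := n + 1) (by omega)]
    -- The two copies of the product are expanded with different numbers of terms, `n + 1` and `n`,
    -- so that the ranges agree after multiplying the second by `y`.
    nth_rewrite 2 [← ih (N := n + 1) (by omega)]
    rw [ih (N := n) (by omega), Finset.sum_range_succ', Finset.sum_range_succ']
    simp only [prodCoeff, map_sub, map_mul, sub_mul, Finset.sum_sub_distrib, Finset.mul_sum]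
    have : ∀ j, GaussianInt.toComplex γ * y * (GaussianInt.toComplex (prodCoeff L j) * y ^ j)
        = GaussianInt.toComplex γ * GaussianInt.toComplex (prodCoeff L j) * y ^ (j + 1) :=
      fun j => by ring
    simp only [this]
    ring

/-- Certified comparison of `θ(q, ·)` with a product of linear factors. The coefficients are
compared by a computation with Gaussian integers. -/
lemma norm_theta_sub_prod_le {q : ℂ} {A : GaussianInt} {L : List GaussianInt} {D K N : ℕ}
    (e : ℕ → ℕ) (hD : D ≠ 0) (hK : K ≠ 0) (hL : L.length < N) {ρ ε R : ℝ} (hq : ‖q‖ ≤ ρ) (hρ : ρ < 1)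
    (hA : ‖GaussianInt.toComplex A / D‖ ≤ 1) (hqA : ‖q - GaussianInt.toComplex A / D‖ ≤ ε)
    (hR : ρ ^ (N + 1) * R ≤ 1 / 2)
    (he : ∀ j < N, (A ^ tri j - prodCoeff L j * (D : GaussianInt) ^ (tri j - j)).norm * K ^ 2
      ≤ (e j * D ^ tri j) ^ 2) {z : ℂ} (hz : ‖z‖ ≤ R) :
    ‖theta q z - (L.map fun γ => 1 - GaussianInt.toComplex γ * (z / D)).prod‖
      ≤ ∑ j ∈ Finset.range N, (tri j * ε + e j / K) * R ^ j + 2 * (ρ ^ tri N * R ^ N) := by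
  have hq1 := hq.trans_lt hρ
  have hρ0 := (norm_nonneg q).trans hq
  have hR0 := (norm_nonneg z).trans hz
  have hD' : (D : ℂ) ≠ 0 := Nat.cast_ne_zero.mpr hD
  have hDp : (0 : ℝ) < D := by positivity
  have hKp : (0 : ℝ) < K := by positivity
  rw [prod_eq_sum_prodCoeff L (z / D) hL, theta_eq_tsum,
    ← (summable_theta hq1 z).sum_add_tsum_nat_add N, add_sub_right_comm, ← Finset.sum_sub_distrib]
  refine (norm_add_le _ _).trans (add_le_add ?_ ?_)
  · refine norm_sum_le_of_le _ fun j hj => ?_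
    -- This makes `D ^ tri j` a common denominator of `(A / D) ^ tri j` and of the polynomial
    -- coefficient over `D ^ j`.
    have hjm : j ≤ tri j := by
      cases j with
      | zero => simp
      | succ j => rw [tri_succ]; omega
    have e1 : q ^ tri j * z ^ j - GaussianInt.toComplex (prodCoeff L j) * (z / D) ^ j
        = ((q ^ tri j - (GaussianInt.toComplex A / D) ^ tri j)
          + GaussianInt.toComplex (A ^ tri j - prodCoeff L j * (D : GaussianInt) ^ (tri j - j))
            / (D : ℂ) ^ tri j) * z ^ j := by
      obtain ⟨i, hi⟩ := Nat.exists_eq_add_of_le hjm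
      simp only [map_sub, map_mul, map_pow, map_natCast]
      rw [hi, Nat.add_sub_cancel_left, div_pow, div_pow, pow_add (D : ℂ)]
      field_simp
      ring
    have hε := (norm_nonneg _).trans hqA
    rw [e1, norm_mul, norm_pow]
    refine mul_le_mul ((norm_add_le _ _).trans (add_le_add ?_ ?_))
      (pow_le_pow_left₀ (norm_nonneg z) hz j) (by positivity) (by positivity)
    · have := norm_pow_sub_pow_le_of_norm_le one_pos hq1.le hA (tri j)
      rw [one_pow, div_one, mul_one] at this
      exact this.trans (by gcongr)
    · rw [norm_div, norm_pow, Complex.norm_natCast, div_le_div_iff₀ (by positivity) hKp]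
      refine le_of_sq_le_sq ?_ (by positivity)
      rw [mul_pow, sq_norm_toComplex]
      exact_mod_cast he j (Finset.mem_range.mp hj)
  · refine le_trans (tsum_of_norm_bounded
      ((summable_nat_add_iff N).mpr (summable_majorant hρ0 hρ R)).hasSum
      fun j => ?_) (majorant_shift_le hρ0 hρ hR0 N hR)
    rw [norm_mul, norm_pow, norm_pow]
    gcongr

/-- Lower bound for a linear factor on a large circle. -/
lemma norm_one_sub_div_ge {z a : ℂ} {R M : ℝ} (ha : a ≠ 0) (haM : ‖a‖ ≤ M) (hz : ‖z‖ = R) :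
    R / M - 1 ≤ ‖1 - z / a‖ := by
  have h := norm_sub_norm_le (z / a) 1
  rw [norm_one, norm_div, hz, norm_sub_rev] at h
  have : R / M ≤ R / ‖a‖ := div_le_div_of_nonneg_left (hz ▸ norm_nonneg z) (norm_pos_iff.mpr ha) haM
  linarith

/-- Lower bound for a linear factor in a small disc. -/
lemma norm_one_sub_mul_ge {z c : ℂ} {R M : ℝ} (hc : ‖c‖ ≤ M) (hz : ‖z‖ ≤ R) :
    1 - M * R ≤ ‖1 - c * z‖ := by
  have h := norm_sub_norm_le 1 (c * z)
  rw [norm_one, norm_mul] at h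
  have : ‖c‖ * ‖z‖ ≤ M * R := mul_le_mul hc hz (norm_nonneg _) ((norm_nonneg _).trans hc)
  linarith

/-- Approximate reciprocals are certified through the residual `1 - a₀ γ`, which is a polynomial in
the data and hence can be computed exactly. -/
lemma norm_inv_sub_scaled_le {a a₀ : ℂ} {γ : ℂ} {τ : ℝ} (ha : 1 ≤ ‖a‖) (hγ : ‖γ‖ ≤ 1)
    (haa : ‖a - a₀‖ ≤ τ) (h : ‖1 - a₀ * γ‖ ≤ τ) : ‖1 / a - γ‖ ≤ 2 * τ := by
  have ha0 : a ≠ 0 := norm_pos_iff.mp (by linarith)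
  have e : 1 / a - γ = ((1 - a₀ * γ) - (a - a₀) * γ) / a := by field_simp; ring
  have hτ := (norm_nonneg _).trans h
  rw [e, norm_div, div_le_iff₀ (by linarith)]
  have h2 : ‖(a - a₀) * γ‖ ≤ τ := by
    rw [norm_mul]
    calc _ ≤ τ * 1 := by gcongr
      _ = τ := mul_one τ
  calc _ ≤ τ + τ := norm_sub_le_of_le h h2
    _ ≤ 2 * τ * ‖a‖ := by nlinarith


/-! ### The zeros in the central disc for the spectral values -/

lemma scaled_mul_div (g : GaussianInt) (z : ℂ) :
    GaussianInt.toComplex g * (z / (10 ^ 30 : ℕ)) = scaled g * z := by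
  rw [scaled]; ring

lemma norm_one_sub_scaled_mul_le {g h : GaussianInt}
    (H : ((10 ^ 60 : ℕ) - g * h : GaussianInt).norm ≤ (10 ^ 42 : ℕ) ^ 2) :
    ‖1 - scaled g * scaled h‖ ≤ 1 / 10 ^ 16 := by
  have e : 1 - scaled g * scaled h
      = GaussianInt.toComplex ((10 ^ 60 : ℕ) - g * h : GaussianInt) / (10 ^ 60 : ℕ) := by
    rw [scaled, scaled, map_sub, map_mul, map_natCast]
    push_cast
    field_simp
    ring
  rw [e]
  exact norm_toComplex_div_le H (by norm_num) (by norm_num)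

lemma one_sub_div_sub (z a γ : ℂ) : (1 - z / a) - (1 - γ * z) = -((1 / a - γ) * z) := by ring

/-- The reciprocal of the double zero for the real spectral value. -/
def xInv : GaussianInt := ⟨-133275474642658098524027335769, 0⟩
/-- The reciprocal of the simple zero for the complex spectral value. -/
def aInv : GaussianInt := ⟨-253232019091194617775988582743, 114572472042475562720625101433⟩
/-- The reciprocal of the double zero for the complex spectral value. -/
def bInv : GaussianInt := ⟨-81880789472044201442908109654, -83814588233472984893867418962⟩

/-- Zeros of an approximating polynomial for the real spectral value. -/
def realFactors : List GaussianInt := [xInv, xInv, ⟨-263 * 10 ^ 26, 0⟩, ⟨-164 * 10 ^ 26, 0⟩]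

/-- Zeros of an approximating polynomial for the complex spectral value. -/
def complexFactors : List GaussianInt :=
  [aInv, bInv, bInv, ⟨-19010 * 10 ^ 24, -37291 * 10 ^ 24⟩, ⟨-2370 * 10 ^ 24, -17099 * 10 ^ 24⟩,
    ⟨-2575 * 10 ^ 24, -12317 * 10 ^ 24⟩, ⟨5631 * 10 ^ 24, -3281 * 10 ^ 24⟩]

/-- Bounds for the differences of coefficients for the real spectral value. -/
def realErr (j : ℕ) : ℕ :=
  [1, 161068524, 28973224, 126581800, 33870190, 2262725, 1980, 1].getD j 0

/-- Bounds for the differences of coefficients for the complex spectral value. -/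
def complexErr (j : ℕ) : ℕ :=
  [1, 113589790, 51824714, 10562721, 951929, 45521, 4834, 739].getD j 0

lemma tri_values : tri 1 = 1 ∧ tri 2 = 3 ∧ tri 3 = 6 ∧ tri 4 = 10 ∧ tri 5 = 15 ∧ tri 6 = 21 ∧
    tri 7 = 28 ∧ tri 8 = 36 := by decide

/-- The comparison polynomial has the approximate double zero and two roots beyond radius `19`.
Coefficients up to degree `7` are compared in units of `10 ^ (-14)`, the polynomial having degree
`4`. Any bound well below `0.66 / 2` would do for the Rouché step. -/
lemma norm_theta_sub_realFactors_le {q : ℂ} (hq : ‖q - scaled qNum‖ ≤ 1 / 10 ^ 18) {z : ℂ}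
    (hz : ‖z‖ ≤ 19) :
    ‖theta q z - (1 - scaled xInv * z) ^ 2 * ((1 - scaled ⟨-263 * 10 ^ 26, 0⟩ * z)
      * (1 - scaled ⟨-164 * 10 ^ 26, 0⟩ * z))‖ ≤ 12 / 100 := by
  have h1 : ‖q‖ ≤ 3094 / 10000 := by
    have := norm_add_le (q - scaled qNum) (scaled qNum)
    rw [sub_add_cancel] at this
    linarith [norm_qNum_le]
  have h := norm_theta_sub_prod_le (K := 10 ^ 14) (N := 8) (L := realFactors) (R := 19) realErr
    (by norm_num : 10 ^ 30 ≠ 0) (by norm_num) (by decide) h1 (by norm_num)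
    (norm_qNum_le.trans (by norm_num)) hq (by norm_num) (by decide +kernel) hz
  simp only [realFactors, List.map_cons, List.map_nil, List.prod_cons, List.prod_nil, mul_one,
    scaled_mul_div] at h
  refine le_trans (le_of_eq ?_) (h.trans ?_)
  · congr 1; ring
  · norm_num [Finset.sum_range_succ, tri_values, tri_zero, realErr]

lemma norm_theta_sub_complexFactors_le {q : ℂ} (hq : ‖q - scaled vNum‖ ≤ 1 / 10 ^ 18) {z : ℂ}
    (hz : ‖z‖ ≤ 160605003908 / 10 ^ 10) :
    ‖theta q z - (1 - scaled aInv * z) * (1 - scaled bInv * z) ^ 2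
      * ((1 - scaled ⟨-19010 * 10 ^ 24, -37291 * 10 ^ 24⟩ * z)
        * (1 - scaled ⟨-2370 * 10 ^ 24, -17099 * 10 ^ 24⟩ * z)
        * ((1 - scaled ⟨-2575 * 10 ^ 24, -12317 * 10 ^ 24⟩ * z)
        * (1 - scaled ⟨5631 * 10 ^ 24, -3281 * 10 ^ 24⟩ * z)))‖ ≤ 1 / 100 := by
  have h1 : ‖q‖ ≤ 4524 / 10000 := by
    have := norm_add_le (q - scaled vNum) (scaled vNum)
    rw [sub_add_cancel] at this
    linarith [norm_vNum_le]
  have h := norm_theta_sub_prod_le (K := 10 ^ 14) (N := 8) (L := complexFactors)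
    (R := 160605003908 / 10 ^ 10) complexErr
    (by norm_num : 10 ^ 30 ≠ 0) (by norm_num) (by decide) h1 (by norm_num)
    (norm_vNum_le.trans (by norm_num)) hq (by norm_num) (by decide +kernel) hz
  simp only [complexFactors, List.map_cons, List.map_nil, List.prod_cons, List.prod_nil, mul_one,
    scaled_mul_div] at h
  refine le_trans (le_of_eq ?_) (h.trans ?_)
  · congr 1; ring
  · norm_num [Finset.sum_range_succ, tri_values, tri_zero, complexErr]

/-- `θ(q, ·)` has no zeros in the disc of radius `19` besides the double zero. -/
lemma cofactor_ne_zero_real {q x : ℂ} {g : ℂ → ℂ} (hq : ‖q - scaled qNum‖ ≤ 1 / 10 ^ 18)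
    (hx : ‖x - scaled xNum‖ ≤ 1 / 10 ^ 18) (hg : Differentiable ℂ g)
    (h : ∀ z, theta q z = (1 - z / x) ^ 2 * g z) {z : ℂ} (hz : ‖z‖ ≤ 19) : g z ≠ 0 := by
  set c₁ : GaussianInt := ⟨-263 * 10 ^ 26, 0⟩ with hc₁
  set c₂ : GaussianInt := ⟨-164 * 10 ^ 26, 0⟩ with hc₂
  have n1 : ‖scaled c₁‖ ≤ 27 / 1000 := norm_scaled_le (27 * 10 ^ 27) (by decide +kernel) (by norm_num)
  have n2 : ‖scaled c₂‖ ≤ 17 / 1000 := norm_scaled_le (17 * 10 ^ 27) (by decide +kernel) (by norm_num)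
  have nx : ‖scaled xInv‖ ≤ 3 / 10 := norm_scaled_le (3 * 10 ^ 29) (by decide +kernel) (by norm_num)
  have hx1 : 1 ≤ ‖x‖ := by
    have := norm_sub_norm_le (scaled xNum) (scaled xNum - x)
    rw [sub_sub_cancel, norm_sub_rev] at this
    linarith [le_norm_xNum]
  have hx2 : ‖x‖ ≤ 76 / 10 := by
    have := norm_add_le (x - scaled xNum) (scaled xNum)
    rw [sub_add_cancel] at this
    linarith [norm_xNum_le]
  have hx0 : x ≠ 0 := norm_pos_iff.mp (by linarith)
  have hinv : ‖1 / x - scaled xInv‖ ≤ 2 * (1 / 10 ^ 16) :=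
    norm_inv_sub_scaled_le hx1 (nx.trans (by norm_num)) (hx.trans (by norm_num))
      (norm_one_sub_scaled_mul_le (by decide +kernel))
  have hBlow : ∀ w : ℂ, ‖w‖ ≤ 19 → 3 / 10 ≤ ‖(1 - scaled c₁ * w) * (1 - scaled c₂ * w)‖ := by
    intro w hw
    have a1 := norm_one_sub_mul_ge n1 hw
    have a2 := norm_one_sub_mul_ge n2 hw
    rw [norm_mul]
    calc (3 / 10 : ℝ) ≤ (1 - 27 / 1000 * 19) * (1 - 17 / 1000 * 19) := by norm_num
      _ ≤ _ := mul_le_mul a1 a2 (by norm_num) (norm_nonneg _)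
  -- Together with `hBlow` this gives `‖P * B‖ ≥ 0.66` on the circle, whereas the total error stays
  -- below `0.13`.
  have hPlow : ∀ w : ℂ, ‖w‖ = 19 → 22 / 10 ≤ ‖(1 - w / x) ^ 2‖ := by
    intro w hw
    have a := norm_one_sub_div_ge hx0 hx2 hw
    rw [norm_pow]
    calc (22 / 10 : ℝ) ≤ (19 / (76 / 10) - 1) ^ 2 := by norm_num
      _ ≤ _ := pow_le_pow_left₀ (by norm_num) a 2
  refine ne_zero_of_close_on_circle (P := fun w => (1 - w / x) ^ 2)
    (B := fun w => (1 - scaled c₁ * w) * (1 - scaled c₂ * w)) (R := 19) (c := 1 / 2) (by norm_num)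
    hg (by fun_prop) (fun w hw => norm_pos_iff.mp (by linarith [hBlow w hw]))
    (fun w hw => norm_pos_iff.mp (by linarith [hPlow w hw])) (by norm_num) (fun w hw => ?_) hz
  rw [← h w]
  have t := norm_theta_sub_realFactors_le hq hw.le
  set B := (1 - scaled c₁ * w) * (1 - scaled c₂ * w) with hB
  set y := 1 - w / x with hy
  set y₀ := 1 - scaled xInv * w with hy₀
  have hyy : ‖y - y₀‖ ≤ 1 / 10 ^ 13 := by
    rw [hy, hy₀, one_sub_div_sub, norm_neg, norm_mul, hw]
    linarith
  have hy₀n : ‖y₀‖ ≤ 10 := by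
    have := norm_sub_le 1 (scaled xInv * w)
    rw [norm_one, norm_mul, hw] at this
    linarith
  have hyn : ‖y‖ ≤ 11 := by
    have := norm_add_le (y - y₀) y₀
    rw [sub_add_cancel] at this
    linarith
  have hBn : ‖B‖ ≤ 4 := by
    have a1 := norm_sub_le 1 (scaled c₁ * w)
    have a2 := norm_sub_le 1 (scaled c₂ * w)
    rw [norm_one, norm_mul, hw] at a1 a2
    rw [hB, norm_mul]
    calc _ ≤ (2 : ℝ) * 2 := mul_le_mul (by linarith) (by linarith) (norm_nonneg _) (by norm_num)
      _ = 4 := by norm_num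
  have hd : ‖(y₀ ^ 2 - y ^ 2) * B‖ ≤ 1 / 1000 := by
    have e : y₀ ^ 2 - y ^ 2 = -((y - y₀) * (y + y₀)) := by ring
    rw [e, norm_mul, norm_neg, norm_mul]
    have := norm_add_le y y₀
    calc _ ≤ 1 / 10 ^ 13 * (21 : ℝ) * 4 := by gcongr; linarith
      _ ≤ _ := by norm_num
  have e : theta q w - y ^ 2 * B = (theta q w - y₀ ^ 2 * B) + (y₀ ^ 2 - y ^ 2) * B := by ring
  have low : 66 / 100 ≤ ‖y ^ 2 * B‖ := by
    rw [norm_mul]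
    calc (66 / 100 : ℝ) = 22 / 10 * (3 / 10) := by norm_num
      _ ≤ _ := mul_le_mul (hPlow w hw) (hBlow w hw.le) (by norm_num) (norm_nonneg _)
  rw [e]
  refine (norm_add_le_of_le t hd).trans ?_
  linarith

/-- `θ(v, ·)` has only the zeros `a` and `b` in the disc of radius `16.0605003908`. -/
lemma cofactor_ne_zero_complex {v a b : ℂ} {g : ℂ → ℂ} (hv : ‖v - scaled vNum‖ ≤ 1 / 10 ^ 18)
    (ha : ‖a - scaled aNum‖ ≤ 1 / 10 ^ 16) (hb : ‖b - scaled bNum‖ ≤ 1 / 10 ^ 18)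
    (hg : Differentiable ℂ g) (h : ∀ z, theta v z = (1 - z / a) * (1 - z / b) ^ 2 * g z) {z : ℂ}
    (hz : ‖z‖ ≤ 160605003908 / 10 ^ 10) : g z ≠ 0 := by
  set c₁ : GaussianInt := ⟨-19010 * 10 ^ 24, -37291 * 10 ^ 24⟩ with hc₁
  set c₂ : GaussianInt := ⟨-2370 * 10 ^ 24, -17099 * 10 ^ 24⟩ with hc₂
  set c₃ : GaussianInt := ⟨-2575 * 10 ^ 24, -12317 * 10 ^ 24⟩ with hc₃
  set c₄ : GaussianInt := ⟨5631 * 10 ^ 24, -3281 * 10 ^ 24⟩ with hc₄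
  have n1 : ‖scaled c₁‖ ≤ 42 / 1000 := norm_scaled_le (42 * 10 ^ 27) (by decide +kernel) (by norm_num)
  have n2 : ‖scaled c₂‖ ≤ 18 / 1000 := norm_scaled_le (18 * 10 ^ 27) (by decide +kernel) (by norm_num)
  have n3 : ‖scaled c₃‖ ≤ 13 / 1000 := norm_scaled_le (13 * 10 ^ 27) (by decide +kernel) (by norm_num)
  have n4 : ‖scaled c₄‖ ≤ 7 / 1000 := norm_scaled_le (7 * 10 ^ 27) (by decide +kernel) (by norm_num)
  have na : ‖scaled aInv‖ ≤ 3 / 10 := norm_scaled_le (3 * 10 ^ 29) (by decide +kernel) (by norm_num)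
  have nb : ‖scaled bInv‖ ≤ 3 / 10 := norm_scaled_le (3 * 10 ^ 29) (by decide +kernel) (by norm_num)
  have ha1 : 1 ≤ ‖a‖ := by
    have := norm_sub_norm_le (scaled aNum) (scaled aNum - a)
    rw [sub_sub_cancel, norm_sub_rev] at this
    linarith [le_norm_aNum]
  have ha2 : ‖a‖ ≤ 361 / 100 := by
    have := norm_add_le (a - scaled aNum) (scaled aNum)
    rw [sub_add_cancel] at this
    linarith [norm_aNum_le]
  have hb1 : 1 ≤ ‖b‖ := by
    have := norm_sub_norm_le (scaled bNum) (scaled bNum - b)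
    rw [sub_sub_cancel, norm_sub_rev] at this
    linarith [le_norm_bNum]
  have hb2 : ‖b‖ ≤ 855 / 100 := by
    have := norm_add_le (b - scaled bNum) (scaled bNum)
    rw [sub_add_cancel] at this
    linarith [norm_bNum_le]
  have ha0 : a ≠ 0 := norm_pos_iff.mp (by linarith)
  have hb0 : b ≠ 0 := norm_pos_iff.mp (by linarith)
  have hainv : ‖1 / a - scaled aInv‖ ≤ 2 * (1 / 10 ^ 16) :=
    norm_inv_sub_scaled_le ha1 (na.trans (by norm_num)) ha
      (norm_one_sub_scaled_mul_le (by decide +kernel))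
  have hbinv : ‖1 / b - scaled bInv‖ ≤ 2 * (1 / 10 ^ 16) :=
    norm_inv_sub_scaled_le hb1 (nb.trans (by norm_num)) (hb.trans (by norm_num))
      (norm_one_sub_scaled_mul_le (by decide +kernel))
  have hR : (160605003908 / 10 ^ 10 : ℝ) ≤ 161 / 10 := by norm_num
  have hBlow : ∀ w : ℂ, ‖w‖ ≤ 160605003908 / 10 ^ 10 → 1 / 10 ≤
      ‖(1 - scaled c₁ * w) * (1 - scaled c₂ * w) * ((1 - scaled c₃ * w) * (1 - scaled c₄ * w))‖ := by
    intro w hw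
    have hw' := hw.trans hR
    have a1 := norm_one_sub_mul_ge n1 hw'
    have a2 := norm_one_sub_mul_ge n2 hw'
    have a3 := norm_one_sub_mul_ge n3 hw'
    have a4 := norm_one_sub_mul_ge n4 hw'
    rw [norm_mul, norm_mul, norm_mul]
    calc (1 / 10 : ℝ) ≤ (1 - 42 / 1000 * (161 / 10)) * (1 - 18 / 1000 * (161 / 10))
          * ((1 - 13 / 1000 * (161 / 10)) * (1 - 7 / 1000 * (161 / 10))) := by norm_num
      _ ≤ _ := mul_le_mul (mul_le_mul a1 a2 (by norm_num) (norm_nonneg _))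
          (mul_le_mul a3 a4 (by norm_num) (norm_nonneg _)) (by norm_num) (by positivity)
  -- With `hBlow` this gives `‖P * B‖ ≥ 0.2` on the circle, against an error of at most `0.011`.
  have hPlow : ∀ w : ℂ, ‖w‖ = 160605003908 / 10 ^ 10 →
      2 ≤ ‖(1 - w / a) * (1 - w / b) ^ 2‖ := by
    intro w hw
    have a1 := norm_one_sub_div_ge ha0 ha2 hw
    have a2 := norm_one_sub_div_ge hb0 hb2 hw
    rw [norm_mul, norm_pow]
    calc (2 : ℝ) ≤ (160605003908 / 10 ^ 10 / (361 / 100) - 1)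
          * (160605003908 / 10 ^ 10 / (855 / 100) - 1) ^ 2 := by norm_num
      _ ≤ _ := mul_le_mul a1 (pow_le_pow_left₀ (by norm_num) a2 2) (by norm_num) (norm_nonneg _)
  refine ne_zero_of_close_on_circle (P := fun w => (1 - w / a) * (1 - w / b) ^ 2)
    (B := fun w => (1 - scaled c₁ * w) * (1 - scaled c₂ * w)
      * ((1 - scaled c₃ * w) * (1 - scaled c₄ * w)))
    (R := 160605003908 / 10 ^ 10) (c := 1 / 2) (by norm_num)
    hg (by fun_prop) (fun w hw => norm_pos_iff.mp (by linarith [hBlow w hw]))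
    (fun w hw => norm_pos_iff.mp (by linarith [hPlow w hw])) (by norm_num) (fun w hw => ?_) hz
  rw [← h w]
  have t := norm_theta_sub_complexFactors_le hv hw.le
  have hw' := hw.le.trans hR
  set B := (1 - scaled c₁ * w) * (1 - scaled c₂ * w)
      * ((1 - scaled c₃ * w) * (1 - scaled c₄ * w)) with hB
  have fac : ∀ c : ℂ, ‖c‖ ≤ 6 / 100 → ‖1 - c * w‖ ≤ 2 := by
    intro c hc
    have := norm_sub_le 1 (c * w)
    rw [norm_one, norm_mul] at this
    have : ‖c‖ * ‖w‖ ≤ 6 / 100 * (161 / 10) := by gcongr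
    linarith
  have hBn : ‖B‖ ≤ 16 := by
    rw [hB, norm_mul, norm_mul, norm_mul]
    calc _ ≤ (2 : ℝ) * 2 * (2 * 2) := by
          gcongr
          · exact fac _ (by linarith)
          · exact fac _ (by linarith)
          · exact fac _ (by linarith)
          · exact fac _ (by linarith)
      _ = 16 := by norm_num
  have near : ∀ u γ : ℂ, ‖1 / u - γ‖ ≤ 2 * (1 / 10 ^ 16) →
      ‖(1 - w / u) - (1 - γ * w)‖ ≤ 1 / 10 ^ 13 := by
    intro u γ hu
    rw [one_sub_div_sub, norm_neg, norm_mul]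
    calc _ ≤ 2 * (1 / 10 ^ 16 : ℝ) * (161 / 10) := by gcongr
      _ ≤ _ := by norm_num
  have size : ∀ γ : ℂ, ‖γ‖ ≤ 3 / 10 → ‖1 - γ * w‖ ≤ 10 := by
    intro γ hγ
    have := norm_sub_le 1 (γ * w)
    rw [norm_one, norm_mul] at this
    have : ‖γ‖ * ‖w‖ ≤ 3 / 10 * (161 / 10) := by gcongr
    linarith
  have hxx := near a _ hainv
  have hyy := near b _ hbinv
  have hx₀n := size _ na
  have hy₀n := size _ nb
  set x := 1 - w / a with hx
  set x₀ := 1 - scaled aInv * w with hx₀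
  set y := 1 - w / b with hy
  set y₀ := 1 - scaled bInv * w with hy₀
  have hyn : ‖y‖ ≤ 11 := by
    have := norm_add_le (y - y₀) y₀
    rw [sub_add_cancel] at this
    linarith
  have hd : ‖(x₀ * y₀ ^ 2 - x * y ^ 2) * B‖ ≤ 1 / 1000 := by
    have e : x₀ * y₀ ^ 2 - x * y ^ 2 = -((x - x₀) * y ^ 2 + x₀ * ((y - y₀) * (y + y₀))) := by ring
    have h1 : ‖(x - x₀) * y ^ 2‖ ≤ 1 / 10 ^ 13 * 11 ^ 2 := by
      rw [norm_mul, norm_pow]; gcongr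
    have h2 : ‖x₀ * ((y - y₀) * (y + y₀))‖ ≤ 10 * (1 / 10 ^ 13 * 21) := by
      rw [norm_mul, norm_mul]
      have := norm_add_le y y₀
      gcongr
      linarith
    rw [e, norm_mul, norm_neg]
    calc _ ≤ (1 / 10 ^ 13 * 11 ^ 2 + 10 * (1 / 10 ^ 13 * 21)) * (16 : ℝ) := by
          gcongr
          exact norm_add_le_of_le h1 h2
      _ ≤ _ := by norm_num
  have e : theta v w - x * y ^ 2 * B = (theta v w - x₀ * y₀ ^ 2 * B)
      + (x₀ * y₀ ^ 2 - x * y ^ 2) * B := by ring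
  have low : 2 / 10 ≤ ‖x * y ^ 2 * B‖ := by
    rw [norm_mul]
    calc (2 / 10 : ℝ) = 2 * (1 / 10) := by norm_num
      _ ≤ _ := mul_le_mul (hPlow w hw) (hBlow w hw.le) (by norm_num) (norm_nonneg _)
  rw [e]
  refine (norm_add_le_of_le t hd).trans ?_
  linarith


/-! ### Conjugation, factorization and conclusions -/

lemma conj_wtheta (p : ℕ → ℕ) (q z : ℂ) : wtheta p (conj q) (conj z) = conj (wtheta p q z) := by
  rw [wtheta, wtheta, Complex.conj_tsum]
  simp

/-- If `g` is the local cofactor at `z`, then the reflected function `w ↦ conj (g (conj w))` is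
again holomorphic and is the cofactor at `conj z`. -/
lemma IsZeroOfOrder.conj {q z : ℂ} {m : ℕ} (hq : ‖q‖ < 1) (h : IsZeroOfOrder q z m) :
    IsZeroOfOrder (conj q) (conj z) m := by
  obtain ⟨h0, h1⟩ := h
  obtain ⟨g, hg, hg0, hev⟩ := (analyticAt_theta hq z).analyticOrderAt_eq_natCast.mp h1
  have hq' : ‖conj q‖ < 1 := by rwa [Complex.norm_conj]
  have hc : Tendsto (fun w : ℂ => conj w) (𝓝 (conj z)) (𝓝 z) := by
    have := Complex.continuous_conj.tendsto (conj z)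
    rwa [Complex.conj_conj] at this
  refine ⟨by rw [conj_theta, h0, map_zero],
    (analyticAt_theta hq' _).analyticOrderAt_eq_natCast.mpr
      ⟨fun w => conj (g (conj w)), ?_, ?_, ?_⟩⟩
  · rw [Complex.analyticAt_iff_eventually_differentiableAt] at hg ⊢
    filter_upwards [hc.eventually hg] with w hw
    have := hw.hasDerivAt.conj_conj
    rw [Complex.conj_conj] at this
    exact this.differentiableAt
  · simpa using hg0
  · filter_upwards [hc.eventually hev] with w hw
    have := conj_theta q (conj w)
    rw [Complex.conj_conj] at this
    rw [this, hw]
    simp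

lemma IsZeroOfOrder.isSpectralValue {q z : ℂ} (h0 : 0 < ‖q‖) (h1 : ‖q‖ < 1)
    (h : IsZeroOfOrder q z 2) : IsSpectralValue q :=
  ⟨h0, h1, z, h.1, h.2.ge⟩

/-- All terms are nonnegative and the constant term is `1`, so the sum is at least `1`. -/
lemma theta_ofReal_ne_zero {r x : ℝ} (h0 : 0 ≤ r) (h1 : r < 1) (hx : 0 ≤ x) :
    theta (r : ℂ) (x : ℂ) ≠ 0 := by
  have e : theta (r : ℂ) (x : ℂ) = (majorant r x : ℂ) := by
    rw [theta_eq_tsum, majorant, Complex.ofReal_tsum]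
    push_cast
    rfl
  have h : 1 ≤ majorant r x := by
    have := (summable_majorant h0 h1 x).le_tsum 0 fun j _ => by positivity
    simpa [tri_zero, majorant] using this
  rw [e, Complex.ofReal_ne_zero]
  linarith

/-- A common zero of `θ(q, ·)` and `z θ'(q, z)` gives a quadratic factor. -/
lemma exists_eq_sq_mul {q b : ℂ} (hq : ‖q‖ < 1) (hb : b ≠ 0) (h0 : theta q b = 0)
    (h1 : wtheta id q b = 0) :
    ∃ g : ℂ → ℂ, Differentiable ℂ g ∧ ∀ z, theta q z = (z - b) ^ 2 * g z := by
  have hd : deriv (theta q) b = 0 := by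
    rw [← mul_deriv_theta hq] at h1
    exact (mul_eq_zero.mp h1).resolve_left hb
  have h2 : dslope (theta q) b b = 0 := by rw [dslope_same, hd]
  have d1 := differentiable_dslope (differentiable_theta hq) b
  refine ⟨dslope (dslope (theta q) b) b, differentiable_dslope d1 b, fun z => ?_⟩
  rw [eq_mul_dslope h0 z, eq_mul_dslope h2 z]
  ring

lemma qNum_real : conj (scaled qNum) = scaled qNum := by
  rw [Complex.conj_eq_iff_im, scaled_im]
  norm_num [qNum]

lemma xNum_real : conj (scaled xNum) = scaled xNum := by
  rw [Complex.conj_eq_iff_im, scaled_im]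
  norm_num [xNum]

lemma norm_conj_sub_le {w c : ℂ} {t : ℝ} (hc : conj c = c) (h : ‖w - c‖ ≤ t) : ‖conj w - c‖ ≤ t := by
  rwa [← hc, ← map_sub, Complex.norm_conj]

/-- The real spectral value, its double zero, and its other zeros. -/
lemma exists_real_spectral_value : ∃ q x : ℝ, |q - (scaled qNum).re| ≤ 1 / 10 ^ 18 ∧
    |x - (scaled xNum).re| ≤ 1 / 10 ^ 18 ∧ IsZeroOfOrder q x 2 ∧
    ∀ z : ℂ, theta q z = 0 → z ≠ x → z.im = 0 ∧ z.re < -8 ∧ IsZeroOfOrder q z 1 := by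
  obtain ⟨⟨q, x, hq, hx, h0, h1⟩, huniq⟩ := exists_unique_real_double_zero
  -- The approximate solution is real, so the conjugate pair is a solution in the same
  -- neighbourhood; uniqueness makes `q` and `x` real.
  obtain ⟨hqr, hxr⟩ := huniq _ _ _ _ (norm_conj_sub_le qNum_real hq) hq
    (norm_conj_sub_le xNum_real hx) hx (by rw [conj_theta, h0, map_zero])
    (by rw [conj_wtheta, h1, map_zero]) h0 h1
  have hq2 : ‖q‖ ≤ 30935 / 100000 := by
    have := norm_add_le (q - scaled qNum) (scaled qNum)
    rw [sub_add_cancel] at this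
    linarith [norm_scaled_le (g := qNum) (x := 30930 / 100000) 309249338600077480027483387771
      (by decide +kernel) (by norm_num)]
  have hq1 : 30924 / 100000 ≤ ‖q‖ := by
    have := norm_sub_norm_le (scaled qNum) (scaled qNum - q)
    rw [sub_sub_cancel, norm_sub_rev] at this
    linarith [le_norm_scaled (g := qNum) (x := 309245 / 1000000) 309249338600077480027483387771
      (by decide +kernel) (by norm_num)]
  have hx1 : 1 ≤ ‖x‖ := by
    have := norm_sub_norm_le (scaled xNum) (scaled xNum - x)
    rw [sub_sub_cancel, norm_sub_rev] at this
    linarith [le_norm_xNum]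
  have hx2 : ‖x‖ ≤ 19 := by
    have := norm_add_le (x - scaled xNum) (scaled xNum)
    rw [sub_add_cancel] at this
    linarith [norm_xNum_le]
  have hqlt : ‖q‖ < 1 := by linarith
  have hx0 : x ≠ 0 := norm_pos_iff.mp (by linarith)
  obtain ⟨g, hg, hfac⟩ := exists_eq_sq_mul hqlt hx0 h0 h1
  have hg0 : ∀ z, ‖z‖ ≤ 19 → g z ≠ 0 := by
    intro z hz hgz
    refine cofactor_ne_zero_real (g := fun z => x ^ 2 * g z) hq hx (by fun_prop) (fun z => ?_) hz
      (by simp [hgz])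
    rw [hfac]
    field_simp
    ring
  have hqre : ((q.re : ℝ) : ℂ) = q := Complex.conj_eq_iff_re.mp hqr
  have hxre : ((x.re : ℝ) : ℂ) = x := Complex.conj_eq_iff_re.mp hxr
  refine ⟨q.re, x.re, ?_, ?_, ?_, ?_⟩
  · rw [← Complex.sub_re]; exact (Complex.abs_re_le_norm _).trans hq
  · rw [← Complex.sub_re]; exact (Complex.abs_re_le_norm _).trans hx
  · rw [hqre, hxre]
    exact isZeroOfOrder_of_eq hqlt two_ne_zero (hg.analyticAt x) (hg0 x hx2) hfac
  · rw [hqre, hxre]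
    intro z hz hzx
    have hbig : 19 < ‖z‖ := by
      by_contra! hle
      rw [hfac] at hz
      exact mul_ne_zero (pow_ne_zero 2 (sub_ne_zero.mpr hzx)) (hg0 z hle) hz
    have hs : 0 ≤ ‖q‖ := norm_nonneg q
    have hs2 : ‖q‖ = √‖q‖ ^ 2 := (Real.sq_sqrt hs).symm
    have hslow : 556 / 1000 ≤ √‖q‖ := Real.le_sqrt_of_sq_le (by linarith)
    have hsup : √‖q‖ ≤ 5562 / 10000 := Real.sqrt_le_iff.mpr ⟨by norm_num, by linarith⟩
    -- The radius `19` exceeds `0.556 ^ (-5)`, so a zero outside the disc lies in the region of the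
    -- annuli.
    obtain ⟨hone, huniq⟩ := zeros_outside_of_norm_le_real (by linarith) hsup hs2 (z₀ := z) (by
      calc (1 : ℝ) ≤ 19 * (556 / 1000) ^ 5 := by norm_num
        _ ≤ _ := by gcongr) hz
    -- For real `q` the conjugate is a zero of the same modulus, and zeros in this region are
    -- determined by their modulus.
    have hreal : conj z = z := by
      refine huniq _ ?_ (Complex.norm_conj z)
      rw [← hqr, conj_theta, hz, map_zero]
    have hzre : ((z.re : ℝ) : ℂ) = z := Complex.conj_eq_iff_re.mp hreal
    refine ⟨Complex.conj_eq_iff_im.mp hreal, ?_, hone⟩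
    have hqpos : 0 ≤ q.re := by
      have := (Complex.abs_re_le_norm (q - scaled qNum)).trans hq
      rw [Complex.sub_re, scaled_re, abs_le] at this
      norm_num [qNum] at this
      linarith
    have habs : ‖z‖ = |z.re| := by
      rw [← hzre, Complex.norm_real, Real.norm_eq_abs, Complex.ofReal_re]
    rcases le_or_gt 0 z.re with hpos | hneg
    · exfalso
      rw [← hqre, ← hzre] at hz
      refine theta_ofReal_ne_zero hqpos ?_ hpos hz
      exact (Complex.re_le_norm q).trans_lt hqlt
    · rw [habs, abs_of_neg hneg] at hbig
      linarith

/-- The complex spectral value in the upper half plane, its double zero, and its other zeros. -/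
lemma exists_complex_spectral_value : ∃ v a b : ℂ, ‖v - scaled vNum‖ ≤ 1 / 10 ^ 18 ∧
    ‖a - scaled aNum‖ ≤ 1 / 10 ^ 16 ∧ ‖b - scaled bNum‖ ≤ 1 / 10 ^ 18 ∧
    (160605003907 / 10 ^ 10 ≤ ‖v‖ ^ (-(7 / 2) : ℝ) ∧
      ‖v‖ ^ (-(7 / 2) : ℝ) < 160605003908 / 10 ^ 10) ∧
    IsZeroOfOrder v a 1 ∧ IsZeroOfOrder v b 2 ∧
    ∀ z : ℂ, theta v z = 0 → z ≠ a → z ≠ b →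
      IsZeroOfOrder v z 1 ∧ ‖v‖ ^ (-(7 / 2) : ℝ) < ‖z‖ := by
  obtain ⟨v, b, hv, hb, h0, h1⟩ := exists_complex_double_zero
  obtain ⟨a, ha, ha0⟩ := exists_complex_simple_zero hv
  have hv2 : ‖v‖ ≤ 45237376233313 / 10 ^ 14 := by
    -- About fourteen digits of `‖v‖` are used, enough to determine `‖v‖ ^ (-7/2)` to ten decimals
    -- below.
    have := norm_add_le (v - scaled vNum) (scaled vNum)
    rw [sub_add_cancel] at this
    linarith [norm_scaled_le (g := vNum) (x := 452373762333125 / 10 ^ 15) (452373762333125 * 10 ^ 15)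
      (by decide +kernel) (by norm_num)]
  have hv1 : 45237376233312 / 10 ^ 14 ≤ ‖v‖ := by
    have := norm_sub_norm_le (scaled vNum) (scaled vNum - v)
    rw [sub_sub_cancel, norm_sub_rev] at this
    linarith [le_norm_scaled (g := vNum) (x := 452373762333122 / 10 ^ 15) (452373762333122 * 10 ^ 15)
      (by decide +kernel) (by norm_num)]
  have hvlt : ‖v‖ < 1 := by linarith
  have hvpos : 0 < ‖v‖ := by linarith
  have hb1 : 8 ≤ ‖b‖ := by
    have := norm_sub_norm_le (scaled bNum) (scaled bNum - b)
    rw [sub_sub_cancel, norm_sub_rev] at this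
    linarith [le_norm_bNum]
  have hb2 : ‖b‖ ≤ 9 := by
    have := norm_add_le (b - scaled bNum) (scaled bNum)
    rw [sub_add_cancel] at this
    linarith [norm_bNum_le]
  have ha1 : 3 ≤ ‖a‖ := by
    have := norm_sub_norm_le (scaled aNum) (scaled aNum - a)
    rw [sub_sub_cancel, norm_sub_rev] at this
    linarith [le_norm_aNum]
  have ha2 : ‖a‖ ≤ 4 := by
    have := norm_add_le (a - scaled aNum) (scaled aNum)
    rw [sub_add_cancel] at this
    linarith [norm_aNum_le]
  have hane : a ≠ 0 := norm_pos_iff.mp (by linarith)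
  have hbne : b ≠ 0 := norm_pos_iff.mp (by linarith)
  have hab : a ≠ b := fun h => by rw [h] at ha2; linarith
  obtain ⟨g₁, hg₁, hfac₁⟩ := exists_eq_sq_mul hvlt hbne h0 h1
  have hg₁a : g₁ a = 0 := by
    rw [hfac₁] at ha0
    exact (mul_eq_zero.mp ha0).resolve_left (pow_ne_zero 2 (sub_ne_zero.mpr hab))
  obtain ⟨g, hgdef⟩ : ∃ g, g = dslope g₁ a := ⟨_, rfl⟩
  have hg : Differentiable ℂ g := hgdef ▸ differentiable_dslope hg₁ a
  have hfac : ∀ z, theta v z = (z - a) * (z - b) ^ 2 * g z := by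
    intro z
    rw [hfac₁, eq_mul_dslope hg₁a z, hgdef]
    ring
  have hg0 : ∀ z, ‖z‖ ≤ 160605003908 / 10 ^ 10 → g z ≠ 0 := by
    intro z hz hgz
    refine cofactor_ne_zero_complex (g := fun z => -(a * b ^ 2) * g z) hv ha hb (by fun_prop)
      (fun z => ?_) hz (by simp [hgz])
    rw [hfac]
    field_simp
    ring
  -- This identity turns the bounds on the real power into rational inequalities involving squares
  -- and seventh powers.
  have hpow : (‖v‖ ^ (-(7 / 2) : ℝ)) ^ 2 * ‖v‖ ^ 7 = 1 := by
    rw [← Real.rpow_natCast, ← Real.rpow_mul hvpos.le, ← Real.rpow_natCast ‖v‖ 7,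
      ← Real.rpow_add hvpos]
    norm_num
  have hY0 : 0 < ‖v‖ ^ (-(7 / 2) : ℝ) := Real.rpow_pos_of_pos hvpos _
  set Y := ‖v‖ ^ (-(7 / 2) : ℝ) with hY
  have hv7 : 0 < ‖v‖ ^ 7 := pow_pos hvpos 7
  have hlow7 : (45237376233312 / 10 ^ 14 : ℝ) ^ 7 ≤ ‖v‖ ^ 7 := by gcongr
  have hup7 : ‖v‖ ^ 7 ≤ (45237376233313 / 10 ^ 14 : ℝ) ^ 7 := by gcongr
  have hYup : Y < 160605003908 / 10 ^ 10 := by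
    by_contra! hcon
    have : (160605003908 / 10 ^ 10 : ℝ) ^ 2 * (45237376233312 / 10 ^ 14) ^ 7 ≤ Y ^ 2 * ‖v‖ ^ 7 := by
      gcongr
    rw [hpow] at this
    norm_num at this
  have hYlow : 160605003907 / 10 ^ 10 ≤ Y := by
    by_contra! hcon
    have : Y ^ 2 * ‖v‖ ^ 7 ≤ (160605003907 / 10 ^ 10 : ℝ) ^ 2 * (45237376233313 / 10 ^ 14) ^ 7 := by
      gcongr
    rw [hpow] at this
    norm_num at this
  refine ⟨v, a, b, hv, ha, hb, ⟨hYlow, hYup⟩, ?_, ?_, ?_⟩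
  · refine isZeroOfOrder_of_eq (g := fun z => (z - b) ^ 2 * g z) hvlt one_ne_zero
      ((by fun_prop : Differentiable ℂ fun z => (z - b) ^ 2 * g z).analyticAt a) ?_ fun z => ?_
    · exact mul_ne_zero (pow_ne_zero 2 (sub_ne_zero.mpr hab)) (hg0 a (by norm_num; linarith))
    · rw [hfac]; ring
  · refine isZeroOfOrder_of_eq (g := fun z => (z - a) * g z) hvlt two_ne_zero
      ((by fun_prop : Differentiable ℂ fun z => (z - a) * g z).analyticAt b) ?_ fun z => ?_
    · exact mul_ne_zero (sub_ne_zero.mpr hab.symm) (hg0 b (by norm_num; linarith))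
    · rw [hfac]; ring
  · intro z hz hza hzb
    have hbig : 160605003908 / 10 ^ 10 < ‖z‖ := by
      by_contra! hle
      rw [hfac] at hz
      exact mul_ne_zero (mul_ne_zero (sub_ne_zero.mpr hza) (pow_ne_zero 2 (sub_ne_zero.mpr hzb)))
        (hg0 z hle) hz
    have hs2 : ‖v‖ = √‖v‖ ^ 2 := (Real.sq_sqrt hvpos.le).symm
    have hsup : √‖v‖ ≤ 6726 / 10000 := Real.sqrt_le_iff.mpr ⟨by norm_num, by linarith⟩
    have hYz : Y < ‖z‖ := hYup.trans hbig
    refine ⟨(zeros_outside_of_norm_le_complex (Real.sqrt_pos.mpr hvpos) hsup hs2 ?_ hz).1, hYz⟩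
    -- With `s = √‖v‖` one has `Y = s ^ (-7)`, the inner edge of the annulus with `k₀ = 3`, so `‖z‖
    -- > Y` is exactly what the outer estimate needs.
    have : 1 ≤ (‖z‖ * √‖v‖ ^ 7) ^ 2 := by
      have e : (‖z‖ * √‖v‖ ^ 7) ^ 2 = ‖z‖ ^ 2 * (√‖v‖ ^ 2) ^ 7 := by ring
      rw [e, ← hs2, ← hpow]
      gcongr
    exact (one_le_sq_iff₀ (by positivity)).mp this


/-! ### Decimal expansions and the final assembly. -/

lemma abs_re_im_sub_le {z : ℂ} {g : GaussianInt} {ε : ℝ} (h : ‖z - scaled g‖ ≤ ε) :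
    |z.re - g.re / 10 ^ 30| ≤ ε ∧ |z.im - g.im / 10 ^ 30| ≤ ε := by
  rw [← scaled_re, ← scaled_im, ← Complex.sub_re, ← Complex.sub_im]
  exact ⟨(Complex.abs_re_le_norm _).trans h, (Complex.abs_im_le_norm _).trans h⟩

end PartialTheta


theorem proposition4 :
    ∃ (q₁ x₁ : ℝ) (v a b : ℂ),
      -- the three spectral values
      (0.3092493386 ≤ q₁ ∧ q₁ < 0.3092493387) ∧
      (0.4353184958 ≤ v.re ∧ v.re < 0.4353184959) ∧
      (0.1230440085 ≤ v.im ∧ v.im < 0.1230440086) ∧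
      ({(q₁ : ℂ), v, conj v} : Set ℂ) ⊆
        {q : ℂ | 0 < ‖q‖ ∧ ‖q‖ ≤ 1 / 2 ∧ PartialTheta.IsSpectralValue q} ∧
      ({(q₁ : ℂ), v, conj v} : Set ℂ).ncard = 3 ∧
      -- the zeros for the real spectral value
      (-7.5032559643 < x₁ ∧ x₁ ≤ -7.5032559642) ∧
      PartialTheta.IsZeroOfOrder q₁ x₁ 2 ∧
      (∀ z : ℂ, PartialTheta.theta q₁ z = 0 → z ≠ x₁ →
        z.im = 0 ∧ z.re < -8 ∧ PartialTheta.IsZeroOfOrder q₁ z 1) ∧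
      -- the positions of the zeros for the complex spectral values
      (-3.278 < a.re ∧ a.re ≤ -3.277) ∧ (-1.484 < a.im ∧ a.im ≤ -1.483) ∧
      (-5.964 < b.re ∧ b.re ≤ -5.963) ∧ (6.104 ≤ b.im ∧ b.im < 6.105) ∧
      (16.0605003907 ≤ ‖v‖ ^ (-(7 / 2) : ℝ) ∧ ‖v‖ ^ (-(7 / 2) : ℝ) < 16.0605003908) ∧
      -- the zeros for the spectral value in the upper half plane
      PartialTheta.IsZeroOfOrder v a 1 ∧
      PartialTheta.IsZeroOfOrder v b 2 ∧
      (∀ z : ℂ, PartialTheta.theta v z = 0 → z ≠ a → z ≠ b →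
        PartialTheta.IsZeroOfOrder v z 1 ∧ ‖v‖ ^ (-(7 / 2) : ℝ) < ‖z‖) ∧
      -- the zeros for the conjugate spectral value
      PartialTheta.IsZeroOfOrder (conj v) (conj a) 1 ∧
      PartialTheta.IsZeroOfOrder (conj v) (conj b) 2 ∧
      (∀ z : ℂ, PartialTheta.theta (conj v) z = 0 → z ≠ conj a → z ≠ conj b →
        PartialTheta.IsZeroOfOrder (conj v) z 1 ∧ ‖conj v‖ ^ (-(7 / 2) : ℝ) < ‖z‖) := by
  obtain ⟨q, x, hq, hx, hqx, hq_simple⟩ := PartialTheta.exists_real_spectral_value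
  obtain ⟨v, a, b, hv, ha, hb, hpow, hva, hvb, hv_simple⟩ :=
    PartialTheta.exists_complex_spectral_value
  obtain ⟨hv_re, hv_im⟩ := PartialTheta.abs_re_im_sub_le hv
  obtain ⟨ha_re, ha_im⟩ := PartialTheta.abs_re_im_sub_le ha
  obtain ⟨hb_re, hb_im⟩ := PartialTheta.abs_re_im_sub_le hb
  have hvn : ‖v‖ ≤ 4524 / 10000 := by
    have h := norm_le_insert' v (PartialTheta.scaled PartialTheta.vNum)
    linarith [PartialTheta.norm_vNum_le]
  rw [PartialTheta.scaled_re, abs_le] at hq hx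
  rw [abs_le] at hv_re hv_im ha_re ha_im hb_re hb_im
  norm_num [PartialTheta.qNum] at hq
  norm_num [PartialTheta.xNum] at hx
  norm_num [PartialTheta.vNum] at hv_re hv_im
  norm_num [PartialTheta.aNum] at ha_re ha_im
  norm_num [PartialTheta.bNum] at hb_re hb_im
  have him : 0 < v.im := by linarith
  have hv0 : 0 < ‖v‖ := norm_pos_iff.mpr fun h => by simp [h] at him
  have hq0 : 0 < q := by linarith
  have hqn : ‖(q : ℂ)‖ = q := by rw [Complex.norm_real, Real.norm_of_nonneg hq0.le]
  have hvc : ‖conj v‖ = ‖v‖ := Complex.norm_conj v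
  have hcva := hva.conj (by linarith)
  have hcvb := hvb.conj (by linarith)
  refine ⟨q, x, v, a, b, ⟨by linarith, by linarith⟩, ⟨by linarith, by linarith⟩,
    ⟨by linarith, by linarith⟩, ?_, ?_, ⟨by linarith, by linarith⟩, hqx, hq_simple,
    ⟨by linarith, by linarith⟩, ⟨by linarith, by linarith⟩, ⟨by linarith, by linarith⟩,
    ⟨by linarith, by linarith⟩, ⟨by linarith [hpow.1], by linarith [hpow.2]⟩, hva, hvb,
    hv_simple, hcva, hcvb, fun z hz hza hzb => ?_⟩
  · rintro _ (rfl | rfl | rfl)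
    · exact ⟨by linarith, by linarith, hqx.isSpectralValue (by linarith) (by linarith)⟩
    · exact ⟨hv0, by linarith, hvb.isSpectralValue hv0 (by linarith)⟩
    · exact ⟨by linarith, by linarith, hcvb.isSpectralValue (by linarith) (by linarith)⟩
  · have h1 : (q : ℂ) ≠ v := fun h => by simp [← h] at him
    have h2 : (q : ℂ) ≠ conj v := fun h => by
      have := congrArg Complex.im h
      simp at this
      linarith
    have h3 : v ≠ conj v := fun h => by
      have := congrArg Complex.im h
      simp only [Complex.conj_im] at this
      linarith
    rw [Set.ncard_insert_of_notMem (by simp [h1, h2]), Set.ncard_pair h3]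
  -- Zeros for `conj v` are the conjugates of zeros for `v`, so the statement is transported from
  -- the upper half plane.
  · have h0 : PartialTheta.theta v (conj z) = 0 := by
      have := PartialTheta.conj_theta (conj v) z
      rw [Complex.conj_conj] at this
      rw [this, hz, map_zero]
    obtain ⟨h1, h2⟩ := hv_simple (conj z) h0
      (fun h => hza (by rw [← h, Complex.conj_conj]))
      (fun h => hzb (by rw [← h, Complex.conj_conj]))
    have h3 := h1.conj (by linarith)
    rw [Complex.conj_conj] at h3
    rw [Complex.norm_conj] at h2
    exact ⟨h3, by rwa [hvc]⟩
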